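/- Theorem 1.2. Let $q$ be a prime power and let $1\le r\le n$ be integers with $r$ odd. Let $M=M_r(\mathbb F_q^n)$ be the matroid on the ground set $\mathbb F_q^n$ whose independent sets are the linearly independent subsets of size at most $r$, and let $L$ be its lattice of flats with minimal flat $\bot$ (the set of loops). Let $$A(M)=\mathbb Z[x_F : F\in L\setminus\{\bot\}]/(I_1+I_2),$$ graded by $\deg x_F=1$, be its Chow ring, where $I_1$ is generated by the products $x_Fx_G$ with $F,G$ incomparable, and $I_2$ by the sums $\sum_{F\in L,\ i\in F}x_F$, one for each $i\in\mathbb F_q^n$ that is not a loop of $M$. Then each homogeneous component $A^d(M)$ is a torsion-free $\mathbb Z$-module and the Hilbert series $H(t)=\sum_d \operatorname{rank}_{\mathbb Z}A^d(M)\,t^d$ is a polynomial of degree $r-1$. Its Charney–Davis quantity $\mathrm{CD}=(-1)^{(r-1)/2}H(-1)$ is given by the following two formulas. (a) $$\mathrm{CD}=(-1)^{\frac{r-1}{2}}\sum_{k=0}^{(r-1)/2}\binom{n}{2k}_{\!q}E_{2k,q}.$$ (b) $$\mathrm{CD}=(-1)^{\frac{r-1}{2}}\Bigl(1+[n]_q!\sum_{a=1}^{(r-1)/2}\frac{(-1)^a}{[n-2a]_q!}\Delta_{a,q}\Bigr),$$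 where $\Delta_{a,q}$ is the determinant of the $a\times a$ matrix whose $(i,j)$ entry is $1/[2(i-j+1)]_q!$ if $j\le i$, $1$ if $j=i+1$, and $0$ if $j>i+1$. Here $[m]_q=1+q+\dots+q^{m-1}$, $[m]_q!=[1]_q[2]_q\cdots[m]_q$, $\binom{m}{k}_q=\frac{[m]_q!}{[k]_q!\,[m-k]_q!}$ for $0\le k\le m$, $(q;q)_m=\prod_{i=1}^m(1-q^i)$, and the numbers $E_{m,q}$ are defined by the identity of formal power series $$\sum_{m\ge0}E_{m,q}\frac{t^m}{(q;q)_m}=\frac{1}{\cosh_q(t)}+\frac{\sinh_q(t)}{\cosh_q(t)},\qquad \cosh_q(t)=\sum_{m\ge0}\frac{t^{2m}}{(q;q)_{2m}},\quad \sinh_q(t)=\sum_{m\ge0}\frac{t^{2m+1}}{(q;q)_{2m+1}};$$ the $E_{2k,q}$ are the $q$-secant numbers. -/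

import Mathlib

/-! ### Chow rings of matroids -/

/-- The flats of a matroid `M` other than the minimal flat `⊥ = cl(∅)` (the set of loops). -/
abbrev NonminimalFlat {α : Type*} (M : Matroid α) : Type _ :=
  {F : Set α // M.IsFlat F ∧ F ≠ M.closure ∅}

/-- The relation `x_F x_G = 0` for all pairs of incomparable flats. -/
noncomputable def chowIncomparableRelations {α : Type*} (M : Matroid α) :
    Set (MvPolynomial (NonminimalFlat M) ℤ) :=
  {p | ∃ F G : NonminimalFlat M, ¬ (F.1 ⊆ G.1) ∧ ¬ (G.1 ⊆ F.1) ∧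
    p = MvPolynomial.X F * MvPolynomial.X G}

/-- The linear relations `∑_{F ∋ i} x_F = 0`, one for every element `i` of the ground set that
is not a loop. An element that is not a loop does not lie in `⊥`, so every flat that contains it
is one of the variables; for a loopless matroid `i` runs over the whole ground set. In terms of the
lattice of flats, there is one relation for each atom `cl(i)`, namely `∑_{F ≥ cl(i)} x_F = 0`. -/
noncomputable def chowLinearRelations {α : Type*} (M : Matroid α) :
    Set (MvPolynomial (NonminimalFlat M) ℤ) :=
  {p | ∃ i : α, M.IsNonloop i ∧
    p = ∑ᶠ (F : NonminimalFlat M) (_ : i ∈ F.1), MvPolynomial.X F}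

/-- The ideal `I₁ + I₂` of relations of the Chow ring. -/
noncomputable def chowIdeal {α : Type*} (M : Matroid α) : Ideal (MvPolynomial (NonminimalFlat M) ℤ) :=
  Ideal.span (chowIncomparableRelations M) ⊔ Ideal.span (chowLinearRelations M)

/-- The Chow ring `A(M) = ℤ[x_F : F a flat, F ≠ ⊥] / (I₁ + I₂)` of a finite matroid. -/
abbrev ChowRing {α : Type*} [Finite α] (M : Matroid α) : Type _ :=
  MvPolynomial (NonminimalFlat M) ℤ ⧸ chowIdeal M

/-- The degree `d` component `A^d(M)` of the Chow ring: the classes of the homogeneous polynomials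
of degree `d`, where every variable has degree one. -/
noncomputable def chowComponent {α : Type*} [Finite α] (M : Matroid α) (d : ℕ) : Submodule ℤ (ChowRing M) :=
  (MvPolynomial.homogeneousSubmodule (NonminimalFlat M) ℤ d).map
    (Ideal.Quotient.mkₐ ℤ (chowIdeal M)).toLinearMap

/-! ### Hilbert series and Charney-Davis quantity -/

/-- The Hilbert series `∑_d (rank_ℤ R_d) t^d` of a graded `ℤ`-algebra with components `R_d`. -/
noncomputable def hilbertSeries {R : Type*} [Ring R] (A : ℕ → Submodule ℤ R) : PowerSeries ℤ :=
  PowerSeries.mk fun d => (Module.finrank ℤ (A d) : ℤ)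

/-- `(-1)^{m/2} p(-1)` if the degree `m` of the polynomial `p` is even, `p(-1)` if it is odd. -/
noncomputable def charneyDavisOfPolynomial (p : Polynomial ℤ) : ℤ :=
  if Even p.natDegree then (-1) ^ (p.natDegree / 2) * p.eval (-1) else p.eval (-1)

open Classical in
/-- The Charney-Davis quantity of a graded `ℤ`-algebra whose Hilbert series `H` is a polynomial of
degree `m`: it is `(-1)^{m/2} H(-1)` for even `m` and `H(-1)` for odd `m`.
(It is `0` by convention when the Hilbert series is not a polynomial.) -/
noncomputable def charneyDavis {R : Type*} [Ring R] (A : ℕ → Submodule ℤ R) : ℤ :=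
  if h : ∃ p : Polynomial ℤ, (p : PowerSeries ℤ) = hilbertSeries A then
    charneyDavisOfPolynomial h.choose
  else 0

/-- The chosen polynomial does not matter. -/
theorem charneyDavis_eq {R : Type*} [Ring R] (A : ℕ → Submodule ℤ R) (p : Polynomial ℤ)
    (hp : (p : PowerSeries ℤ) = hilbertSeries A) :
    charneyDavis A = charneyDavisOfPolynomial p := by
  have h : ∃ p : Polynomial ℤ, (p : PowerSeries ℤ) = hilbertSeries A := ⟨p, hp⟩
  have h2 : h.choose = p := Polynomial.coe_injective ℤ (h.choose_spec.trans hp.symm)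
  rw [charneyDavis, dif_pos h, h2]

/-! ### The matroid `M_r(F^n)` -/

/-- The augmentation property of linearly independent sets of size at most `r`. -/
theorem linearIndepOn_exists_augment {K V : Type*} [Field K] [AddCommGroup V] [Module K V]
    [Finite V] {I J : Set V} (hI : LinearIndepOn K id I) (hJ : LinearIndepOn K id J)
    (hlt : I.ncard < J.ncard) : ∃ e ∈ J, e ∉ I ∧ LinearIndepOn K id (insert e I) := by
  by_contra! hcon
  have hsub : J ⊆ (Submodule.span K I : Set V) := by
    intro e he
    by_contra hne
    have heI : e ∉ I := fun h => hne (Submodule.subset_span h)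
    exact hcon e he heI (hI.id_insert hne)
  have hle : Module.finrank K (Submodule.span K J) ≤ Module.finrank K (Submodule.span K I) :=
    Submodule.finrank_mono (Submodule.span_le.2 hsub)
  have key : ∀ S : Set V, LinearIndepOn K id S →
      Module.finrank K (Submodule.span K S) = S.ncard := by
    intro S hS
    have := Fintype.ofFinite S
    rw [finrank_span_set_eq_card hS, Set.ncard_eq_toFinset_card']
  rw [key I hI, key J hJ] at hle
  omega

/-- The matroid `M_r(F^n)` on the ground set `F^n`, for a finite field `F`: its independent sets are
the linearly independent subsets of `F^n` of size at most `r`. -/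
def vectorSpaceMatroid (F : Type*) [Field F] [Finite F] (n r : ℕ) : Matroid (Fin n → F) :=
  (IndepMatroid.ofFinite (E := Set.univ) Set.finite_univ
    (fun I => LinearIndepOn F id I ∧ I.ncard ≤ r)
    ⟨linearIndepOn_empty F id, by simp⟩
    (fun _ _ hJ hIJ => ⟨hJ.1.mono hIJ, (Set.ncard_le_ncard hIJ (Set.toFinite _)).trans hJ.2⟩)
    (fun I J hI hJ hlt => by
      obtain ⟨e, heJ, heI, hins⟩ := linearIndepOn_exists_augment hI.1 hJ.1 hlt
      refine ⟨e, heJ, heI, hins, ?_⟩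
      rw [Set.ncard_insert_of_notMem heI (Set.toFinite _)]
      have := hJ.2
      omega)
    (fun _ _ => Set.subset_univ _)).matroid

/-! ### `q`-analogues -/

/-- The `q`-integer `[n]_q = 1 + q + ⋯ + q^{n-1}`. -/
def qInt (q : ℚ) (n : ℕ) : ℚ := ∑ i ∈ Finset.range n, q ^ i

/-- The `q`-factorial `[n]_q! = [1]_q [2]_q ⋯ [n]_q`. -/
def qFactorial (q : ℚ) (n : ℕ) : ℚ := ∏ i ∈ Finset.range n, qInt q (i + 1)

/-- The `q`-binomial coefficient `[n]_q! / ([k]_q! [n-k]_q!)`, zero for `k > n`. -/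
def qBinomial (q : ℚ) (n k : ℕ) : ℚ :=
  if k ≤ n then qFactorial q n / (qFactorial q k * qFactorial q (n - k)) else 0

/-- The `q`-Pochhammer symbol `(t; q)_n = (1 - t)(1 - tq) ⋯ (1 - tq^{n-1})`. -/
def qPochhammer (t q : ℚ) (n : ℕ) : ℚ := ∏ i ∈ Finset.range n, (1 - t * q ^ i)

/-- `cosh_q(t) = ∑_{n ≥ 0} t^{2n} / (q; q)_{2n}`. -/
def coshq (q : ℚ) : PowerSeries ℚ :=
  PowerSeries.mk fun m => if Even m then 1 / qPochhammer q q m else 0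

/-- `sinh_q(t) = ∑_{n ≥ 0} t^{2n+1} / (q; q)_{2n+1}`. -/
def sinhq (q : ℚ) : PowerSeries ℚ :=
  PowerSeries.mk fun m => if Odd m then 1 / qPochhammer q q m else 0

/-- `sech_q(t) = 1 / cosh_q(t)`. -/
noncomputable def sechq (q : ℚ) : PowerSeries ℚ := (coshq q)⁻¹

/-- `tanh_q(t) = sinh_q(t) / cosh_q(t)`. -/
noncomputable def tanhq (q : ℚ) : PowerSeries ℚ := sinhq q * (coshq q)⁻¹

/-- The `m`-th `q`-tangent-secant number `E_{m,q}`, defined by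
`sech_q(t) + tanh_q(t) = ∑_m E_{m,q} t^m / (q; q)_m`. The numbers `E_{2k,q}` are the `q`-secant
numbers. -/
noncomputable def qTangentSecant (q : ℚ) (m : ℕ) : ℚ :=
  qPochhammer q q m * PowerSeries.coeff m (sechq q + tanhq q)

/-- The `a × a` matrix with entries `1 / [2(i-j+1)]_q!` on and below the diagonal, `1` just above
the diagonal, and `0` elsewhere. -/
def secantMatrix (q : ℚ) (a : ℕ) : Matrix (Fin a) (Fin a) ℚ :=
  Matrix.of fun i j =>
    if j.val ≤ i.val then 1 / qFactorial q (2 * (i.val - j.val + 1))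
    else if j.val = i.val + 1 then 1
    else 0

/-- The determinant `Δ_{a,q}`. -/
def secantDet (q : ℚ) (a : ℕ) : ℚ := (secantMatrix q a).det

/-! ### Geometric rank functions -/

/-! For F ≠ ⊥ put h_F = ∑_{G ≥ F} x_G, and h_⊥ = 0. By upward Möbius inversion the relations of the
Chow ring amount to h_e = 0 for atoms e and (h_F - h_{F ∨ G})(h_G - h_{F ∨ G}) = 0. These straighten
every monomial in the h_F to monomials supported on chains in which each multiplicity is smaller
than the rank jump from ⊥ and from every lower member (`prod_map_mem_span`).

Such monomials are independent because each of them, say a, has a dual functional. Cut the lattice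
by the chain C of members of a. The functional is 1 on a monomial that has as many factors in each
interval of C as a has and satisfies the dragon Hall–Rado rank condition in each interval, and 0 on
all others. Submodularity of the rank makes it vanish on the relations (`chainWeight_quadratic`),
and the values are unitriangular with respect to total rank. So A^d(M) is free, and its rank is a
number of multisets.

Hence H(-1) is a signed count of multisets. Stripping off the largest member x leaves an alternating
sum over its multiplicity, which retains only the flats y < x with rank of the same parity as x. Odd
ranks therefore contribute 0, and on even ranks the contribution is the Möbius function from ⊥ of
the subposet of flats of even rank. Flats of rank below r are subspaces, counted by Gaussian
binomials, so the recursion is cosh_q · sech_q = 1 and a flat of rank 2k contributes E_{2k,q}. The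
truncated top flat has odd rank r and contributes nothing. Summing over flats gives (a); (b) follows
because the coefficients of a reciprocal power series are Hessenberg determinants, by Cramer's rule.
-/

/-- `rk` is the rank function of a geometric lattice. -/
structure IsGeometricRank {L : Type*} [SemilatticeSup L] [OrderBot L] (rk : L → ℕ) : Prop where
  rk_bot : rk ⊥ = 0
  strictMono : StrictMono rk
  rk_sup_add_le : ∀ x y z : L, z ≤ x → z ≤ y → rk (x ⊔ y) + rk z ≤ rk x + rk y
  exists_atom : ∀ x y : L, ¬ y ≤ x → ∃ e, rk e = 1 ∧ e ≤ y ∧ ¬ e ≤ x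

/-! ### Dragon Hall–Rado weights relative to a chain. -/

section ChainFunctional

variable {L : Type*} [SemilatticeSup L] [OrderBot L]

open Classical in
/-- The join of the members of `C` that do not lie above `x`. -/
noncomputable def chainFloor (C : Finset L) (x : L) : L := (C.filter fun c => ¬ x ≤ c).sup id

/-- The dragon Hall–Rado condition in each of the intervals cut out by the chain `C`. -/
def DragonHallRado (rk : L → ℕ) (C : Finset L) (m : Multiset L) : Prop :=
  ∀ T ≤ m, T ≠ 0 → ∀ b, (∀ x ∈ T, chainFloor C x = b) → rk b + T.card + 1 ≤ rk (b ⊔ T.sup)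

/-- A member of C fails to lie above x ⊔ y exactly when it fails to lie above x or above y, so the
two index sets unite. -/
theorem chainFloor_sup (C : Finset L) (x y : L) :
    chainFloor C (x ⊔ y) = chainFloor C x ⊔ chainFloor C y := by
  classical
  unfold chainFloor
  rw [← Finset.sup_union, ← Finset.filter_or]
  simp only [sup_le_iff, not_and_or]

theorem le_chainFloor_of_not_le {C : Finset L} {x c : L} (hc : c ∈ C) (h : ¬ x ≤ c) :
    c ≤ chainFloor C x := by
  classical
  exact Finset.le_sup (f := id) (Finset.mem_filter.2 ⟨hc, h⟩)

/-- On a chain the join is a maximum. The value ⊥ is separate because it is the join of the empty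
set and need not belong to C. -/
theorem chainFloor_eq_bot_or {C : Finset L} (hC : IsChain (· ≤ ·) (C : Set L)) (x : L) :
    chainFloor C x = ⊥ ∨ (chainFloor C x ∈ C ∧ ¬ x ≤ chainFloor C x) := by
  classical
  refine Finset.sup_mem (t := C.filter fun c => ¬ x ≤ c) (p := id)
    {y | y = ⊥ ∨ (y ∈ C ∧ ¬ x ≤ y)} (Or.inl rfl) ?_ ?_
  · rintro y (rfl | hy) z hz
    · simpa using hz
    rcases hz with rfl | hz
    · simpa using Or.inr hy
    rcases hC.total hy.1 hz.1 with h | h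
    · rw [sup_eq_right.2 h]; exact Or.inr hz
    · rw [sup_eq_left.2 h]; exact Or.inr hy
  · intro y hy
    exact Or.inr (Finset.mem_filter.1 hy)

theorem chainFloor_le_total {C : Finset L} (hC : IsChain (· ≤ ·) (C : Set L)) (x y : L) :
    chainFloor C x ≤ chainFloor C y ∨ chainFloor C y ≤ chainFloor C x := by
  rcases chainFloor_eq_bot_or hC x with h | h
  · rw [h]; exact Or.inl bot_le
  rcases chainFloor_eq_bot_or hC y with h' | h'
  · rw [h']; exact Or.inr bot_le
  exact hC.total h.1 h'.1

theorem le_chainFloor_of_lt {C : Finset L} (hC : IsChain (· ≤ ·) (C : Set L)) {x y : L}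
    (h : chainFloor C x < chainFloor C y) : x ≤ chainFloor C y := by
  rcases chainFloor_eq_bot_or hC y with h' | h'
  · rw [h'] at h; exact absurd h not_lt_bot
  by_contra hx
  exact h.not_ge (le_chainFloor_of_not_le h'.1 hx)

theorem chainFloor_lt {C : Finset L} (hC : IsChain (· ≤ ·) (C : Set L)) {c : L} (hc : c ∈ C)
    (hbot : c ≠ ⊥) : chainFloor C c < c := by
  rcases chainFloor_eq_bot_or hC c with h | h
  · rw [h]; exact bot_lt_iff_ne_bot.2 hbot
  rcases hC.total hc h.1 with h' | h'
  · exact absurd h' h.2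
  · exact lt_of_le_not_ge h' h.2

/-- Otherwise c would be one of the members joined in the floor of x, giving c ≤ floor of c < c.
This is the source of triangularity. -/
theorem le_of_chainFloor_eq {C : Finset L} (hC : IsChain (· ≤ ·) (C : Set L)) {x c : L}
    (hc : c ∈ C) (hbot : c ≠ ⊥) (h : chainFloor C x = chainFloor C c) : x ≤ c := by
  by_contra hx
  exact (chainFloor_lt hC hc hbot).not_ge (h ▸ le_chainFloor_of_not_le hc hx)

/-- Sub-multisets either omit x or have the form x plus T. In the second case x itself adds one to
the cardinality, whence the constant 2. -/
theorem dragonHallRado_cons {rk : L → ℕ} {C : Finset L} {x : L} {m : Multiset L} :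
    DragonHallRado rk C (x ::ₘ m) ↔ DragonHallRado rk C m ∧
      ∀ T ≤ m, (∀ y ∈ T, chainFloor C y = chainFloor C x) →
        rk (chainFloor C x) + T.card + 2 ≤ rk (chainFloor C x ⊔ x ⊔ T.sup) := by
  have key : ∀ P : Multiset L → Prop,
      (∀ T ≤ x ::ₘ m, P T) ↔ (∀ T ≤ m, P T) ∧ ∀ T ≤ m, P (x ::ₘ T) := by
    intro P
    simp only [← Multiset.mem_powerset, Multiset.powerset_cons, Multiset.mem_add,
      Multiset.mem_map, or_imp, forall_and, forall_exists_index, and_imp, forall_apply_eq_imp_iff₂]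
  unfold DragonHallRado
  rw [key]
  refine and_congr Iff.rfl (forall₂_congr fun T _ => ?_)
  constructor
  · intro h hT
    have := h (Multiset.cons_ne_zero) (chainFloor C x) (by simpa using hT)
    simp only [Multiset.card_cons, Multiset.sup_cons, ← sup_assoc] at this
    omega
  · intro h _ b hb
    obtain rfl := hb x (Multiset.mem_cons_self _ _)
    have := h fun y hy => hb y (Multiset.mem_cons_of_mem hy)
    simp only [Multiset.card_cons, Multiset.sup_cons, ← sup_assoc]
    omega

/-- The sub-multiset {e} would have to raise the rank by 2, but joining an atom raises it by at most
1. -/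
theorem DragonHallRado.not_atom_mem {rk : L → ℕ} (hrk : IsGeometricRank rk) {C : Finset L}
    {m : Multiset L} {e : L} (he : rk e = 1) : ¬ DragonHallRado rk C (e ::ₘ m) := by
  intro h
  have h1 := (dragonHallRado_cons.1 h).2 0 (Multiset.zero_le _) (by simp)
  have h2 := hrk.rk_sup_add_le (chainFloor C e) e ⊥ bot_le bot_le
  simp only [Multiset.card_zero, Multiset.sup_zero, sup_bot_eq] at h1
  rw [hrk.rk_bot] at h2
  omega

/-- The condition sees x only through its floor b and the join b ⊔ x. -/
theorem dragonHallRado_cons_congr {rk : L → ℕ} {C : Finset L} {x y : L} {m : Multiset L}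
    (hb : chainFloor C x = chainFloor C y) (h : chainFloor C y ⊔ x = chainFloor C y ⊔ y) :
    DragonHallRado rk C (x ::ₘ m) ↔ DragonHallRado rk C (y ::ₘ m) := by
  rw [dragonHallRado_cons, dragonHallRado_cons, hb, h]

open Classical in
/-- The indicator of the dragon Hall–Rado condition among the multisets with prescribed number of
members in each of the intervals of the chain `C`. -/
noncomputable def chainWeight (rk : L → ℕ) (C : Finset L) (n m : Multiset L) : ℤ :=
  if m.map (chainFloor C) = n ∧ DragonHallRado rk C m then 1 else 0

theorem chainWeight_atom {rk : L → ℕ} (hrk : IsGeometricRank rk) (C : Finset L)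
    (n m : Multiset L) {e : L} (he : rk e = 1) : chainWeight rk C n (e ::ₘ m) = 0 :=
  if_neg fun h => DragonHallRado.not_atom_mem hrk he h.2

theorem chainWeight_congr {rk : L → ℕ} {C : Finset L} {n m : Multiset L} {x y : L}
    (hb : chainFloor C x = chainFloor C y) (h : chainFloor C y ⊔ x = chainFloor C y ⊔ y) :
    chainWeight rk C n (x ::ₘ m) = chainWeight rk C n (y ::ₘ m) := by
  unfold chainWeight
  rw [dragonHallRado_cons_congr hb h, Multiset.map_cons, Multiset.map_cons, hb]

theorem dragonHallRado_cons_cons {rk : L → ℕ} {C : Finset L} {x y : L}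
    {m : Multiset L} (hb : chainFloor C x = chainFloor C y) :
    DragonHallRado rk C (x ::ₘ y ::ₘ m) ↔
      DragonHallRado rk C (x ::ₘ m) ∧ DragonHallRado rk C (y ::ₘ m) ∧
      ∀ T ≤ m, (∀ z ∈ T, chainFloor C z = chainFloor C y) →
        rk (chainFloor C y) + T.card + 3 ≤ rk (chainFloor C y ⊔ (x ⊔ y) ⊔ T.sup) := by
  have key : ∀ P : Multiset L → Prop,
      (∀ T ≤ y ::ₘ m, P T) ↔ (∀ T ≤ m, P T) ∧ ∀ T ≤ m, P (y ::ₘ T) := by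
    intro P
    simp only [← Multiset.mem_powerset, Multiset.powerset_cons, Multiset.mem_add,
      Multiset.mem_map, or_imp, forall_and, forall_exists_index, and_imp, forall_apply_eq_imp_iff₂]
  rw [dragonHallRado_cons, key, dragonHallRado_cons (x := x)]
  constructor
  · rintro ⟨h1, h2, h3⟩
    refine ⟨⟨(dragonHallRado_cons.1 h1).1, h2⟩, h1, fun T hT hz => ?_⟩
    have := h3 T hT (by simpa [hb] using hz)
    simp only [Multiset.card_cons, Multiset.sup_cons] at this
    rw [← hb, ← sup_assoc, sup_assoc _ y]
    omega
  · rintro ⟨⟨h1, h2⟩, h3, h4⟩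
    refine ⟨h3, h2, fun T hT hz => ?_⟩
    have := h4 T hT (by simpa [hb] using hz)
    simp only [Multiset.card_cons, Multiset.sup_cons]
    rw [← hb, ← sup_assoc, sup_assoc _ y] at this
    omega

/-- Two violated rank conditions combine, by submodularity, to a third one. -/
theorem dragonHallRado_or {rk : L → ℕ} (hrk : IsGeometricRank rk) {C : Finset L} {x y : L}
    {m : Multiset L} (hb : chainFloor C x = chainFloor C y) (hm : DragonHallRado rk C m)
    (h : ∀ T ≤ m, (∀ z ∈ T, chainFloor C z = chainFloor C y) →
        rk (chainFloor C y) + T.card + 3 ≤ rk (chainFloor C y ⊔ (x ⊔ y) ⊔ T.sup)) :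
    DragonHallRado rk C (x ::ₘ m) ∨ DragonHallRado rk C (y ::ₘ m) := by
  classical
  by_contra! hcon
  rw [dragonHallRado_cons, dragonHallRado_cons] at hcon
  simp only [hm, true_and, hb] at hcon
  push Not at hcon
  obtain ⟨⟨J, hJm, hJ, hJr⟩, K, hKm, hK, hKr⟩ := hcon
  set b := chainFloor C y
  have h1 := h (J ∪ K) (Multiset.union_le hJm hKm)
    (fun z hz => (Multiset.mem_union.1 hz).elim (hJ z) (hK z))
  have hcard : (J ∪ K).card + (J ∩ K).card = J.card + K.card := by
    rw [← Multiset.card_add, Multiset.union_add_inter, Multiset.card_add]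
  have hle : ∀ z ∈ J ∩ K, z ≤ J.sup ∧ z ≤ K.sup := fun z hz =>
    ⟨Multiset.le_sup (Multiset.mem_inter.1 hz).1, Multiset.le_sup (Multiset.mem_inter.1 hz).2⟩
  have h2 := hrk.rk_sup_add_le (b ⊔ x ⊔ J.sup) (b ⊔ y ⊔ K.sup) (b ⊔ (J ∩ K).sup)
    (sup_le (le_sup_left.trans le_sup_left)
      ((Multiset.sup_le.2 fun z hz => (hle z hz).1).trans le_sup_right))
    (sup_le (le_sup_left.trans le_sup_left)
      ((Multiset.sup_le.2 fun z hz => (hle z hz).2).trans le_sup_right))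
  have h3 : b ⊔ x ⊔ J.sup ⊔ (b ⊔ y ⊔ K.sup) = b ⊔ (x ⊔ y) ⊔ (J ∪ K).sup := by
    rw [Multiset.sup_union]
    ac_rfl
  rw [h3] at h2
  -- The bound without the extra 1 also holds for an empty intersection, and it suffices: the
  -- hypothesis has slack 3, while the two violated conditions together allow only 2.
  have h4 : rk b + (J ∩ K).card ≤ rk (b ⊔ (J ∩ K).sup) := by
    rcases eq_or_ne (J ∩ K) 0 with h0 | h0
    · rw [h0]; simp
    · have := hm (J ∩ K) (Multiset.inter_le_left.trans hJm) h0 b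
        fun z hz => hJ z (Multiset.mem_inter.1 hz).1
      omega
  omega

/-- If the floors differ, the lower of the two elements lies below the floor of the other, so the
latter and x ⊔ y are interchangeable and the terms cancel in pairs. If they agree, let X, Y, Z be
the conditions with x, y, x ⊔ y added to m, and Q the joint one. All four weights require Q, and
what remains is XY - X - Y + Z, which vanishes because under Q the condition Z is equivalent to X or
Y. -/
theorem chainWeight_quadratic {rk : L → ℕ} (hrk : IsGeometricRank rk) {C : Finset L}
    (hC : IsChain (· ≤ ·) (C : Set L)) (n m : Multiset L) (x y : L) :
    chainWeight rk C n (x ::ₘ y ::ₘ m) - chainWeight rk C n (x ::ₘ (x ⊔ y) ::ₘ m) -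
      chainWeight rk C n ((x ⊔ y) ::ₘ y ::ₘ m) +
      chainWeight rk C n ((x ⊔ y) ::ₘ (x ⊔ y) ::ₘ m) = 0 := by
  classical
  have hlt : ∀ x y : L, chainFloor C x < chainFloor C y → ∀ m,
      chainWeight rk C n (y ::ₘ m) = chainWeight rk C n ((x ⊔ y) ::ₘ m) := by
    intro x y hxy m
    have h1 : chainFloor C (x ⊔ y) = chainFloor C y := by
      rw [chainFloor_sup, sup_eq_right.2 hxy.le]
    refine chainWeight_congr h1.symm ?_
    rw [h1, ← sup_assoc, sup_eq_left.2 (le_chainFloor_of_lt hC hxy)]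
  rcases eq_or_ne (chainFloor C x) (chainFloor C y) with hb | hb
  · have hz : chainFloor C (x ⊔ y) = chainFloor C y := by rw [chainFloor_sup, hb, sup_idem]
    have hmono : ∀ w, chainFloor C w = chainFloor C y → w ≤ x ⊔ y →
        DragonHallRado rk C (w ::ₘ m) → DragonHallRado rk C ((x ⊔ y) ::ₘ m) := by
      intro w hw hle h
      rw [dragonHallRado_cons] at h ⊢
      refine ⟨h.1, fun T hT hT' => (h.2 T hT ?_).trans' ?_ |>.trans ?_⟩
      · rwa [hw, ← hz]
      · rw [hw, hz]
      · rw [hw, hz]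
        exact hrk.strictMono.monotone (sup_le_sup_right (sup_le_sup_left hle _) _)
    have e1 := dragonHallRado_cons_cons (rk := rk) (m := m) hb
    have e2 := dragonHallRado_cons_cons (rk := rk) (m := m) (hb.trans hz.symm)
    have e3 := dragonHallRado_cons_cons (rk := rk) (m := m) hz
    have e4 := dragonHallRado_cons_cons (rk := rk) (m := m) (rfl : chainFloor C (x ⊔ y) = _)
    have h5 := @dragonHallRado_or L _ _ rk hrk C x y m hb
    simp only [hz, ← sup_assoc, sup_idem, sup_right_idem] at e1 e2 e3 e4 h5
    have hx := hmono x hb le_sup_left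
    have hy := hmono y rfl le_sup_right
    have hm : DragonHallRado rk C (x ::ₘ m) → DragonHallRado rk C m :=
      fun h => (dragonHallRado_cons.1 h).1
    have hm' : DragonHallRado rk C ((x ⊔ y) ::ₘ m) → DragonHallRado rk C m :=
      fun h => (dragonHallRado_cons.1 h).1
    generalize (∀ T ≤ m, (∀ z ∈ T, chainFloor C z = chainFloor C y) →
      rk (chainFloor C y) + T.card + 3 ≤ rk (chainFloor C y ⊔ x ⊔ y ⊔ T.sup)) = Q at e1 e2 e3 e4 h5
    have hw : ∀ u v, chainFloor C u = chainFloor C y → chainFloor C v = chainFloor C y →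
        chainWeight rk C n (u ::ₘ v ::ₘ m) =
        if chainFloor C y ::ₘ chainFloor C y ::ₘ m.map (chainFloor C) = n ∧
          DragonHallRado rk C (u ::ₘ v ::ₘ m) then 1 else 0 := by
      intro u v hu hv
      unfold chainWeight
      rw [Multiset.map_cons, Multiset.map_cons, hu, hv]
    rw [hw x y hb rfl, hw x _ hb hz, hw _ y hz rfl, hw _ _ hz hz]
    rw [e1, e2, e3, e4]
    clear e1 e2 e3 e4 hw hmono hlt
    generalize DragonHallRado rk C (x ::ₘ m) = X at *
    generalize DragonHallRado rk C (y ::ₘ m) = Y at *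
    generalize DragonHallRado rk C ((x ⊔ y) ::ₘ m) = Z at *
    by_cases hQ : Q <;> by_cases hX : X <;> by_cases hY : Y <;> by_cases hZ : Z <;>
      simp only [hQ, hX, hY, hZ, and_true, and_false, if_false, sub_self, sub_zero, zero_sub,
        zero_add, neg_add_cancel] <;> exfalso <;> tauto
  · rcases chainFloor_le_total hC x y with h | h
    · have := hlt x y (lt_of_le_of_ne h hb)
      rw [Multiset.cons_swap x y, this, Multiset.cons_swap x, Multiset.cons_swap (x ⊔ y) y, this]
      ring
    · have := hlt y x (lt_of_le_of_ne h hb.symm)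
      rw [sup_comm y x] at this
      rw [this, this]
      ring

end ChainFunctional

/-! ### Feichtner–Yuzvinsky multisets and triangularity of the weights. -/

section FYMultiset

open Classical

variable {L : Type*} [SemilatticeSup L] [OrderBot L]

/-- The multisets of lattice elements that index the Feichtner–Yuzvinsky basis of the Chow ring. -/
structure IsFYMultiset (rk : L → ℕ) (a : Multiset L) : Prop where
  isChain : IsChain (· ≤ ·) {x | x ∈ a}
  count_lt : ∀ x ∈ a, a.count x < rk x
  count_add_lt : ∀ x ∈ a, ∀ y ∈ a, x < y → a.count y + rk x < rk y

theorem IsFYMultiset.ne_bot {rk : L → ℕ} (hrk : IsGeometricRank rk) {a : Multiset L}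
    (ha : IsFYMultiset rk a) {x : L} (hx : x ∈ a) : x ≠ ⊥ := by
  rintro rfl
  have := ha.count_lt _ hx
  rw [hrk.rk_bot] at this
  omega

omit [OrderBot L] in
theorem IsFYMultiset.isChain_toFinset {rk : L → ℕ} {a : Multiset L} (ha : IsFYMultiset rk a) :
    IsChain (· ≤ ·) (a.toFinset : Set L) := by
  convert ha.isChain using 1
  ext x
  simp

/-- Members of a with a common floor coincide, so T is one element c repeated, and the condition
becomes the bound on the multiplicity of c over its predecessor in the chain. -/
theorem IsFYMultiset.dragonHallRado {rk : L → ℕ} (hrk : IsGeometricRank rk) {a : Multiset L}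
    (ha : IsFYMultiset rk a) : DragonHallRado rk a.toFinset a := by
  intro T hT hT0 b hb
  have hC := ha.isChain_toFinset
  obtain ⟨c, hc⟩ := Multiset.exists_mem_of_ne_zero hT0
  have hca := Multiset.mem_of_le hT hc
  have hbot : ∀ x ∈ a, x ≠ ⊥ := fun x hx => ha.ne_bot hrk hx
  have hTc : T = Multiset.replicate T.card c := by
    refine Multiset.eq_replicate_card.2 fun x hx => ?_
    have hxa := Multiset.mem_of_le hT hx
    have h1 : chainFloor a.toFinset x = chainFloor a.toFinset c := (hb x hx).trans (hb c hc).symm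
    exact le_antisymm (le_of_chainFloor_eq hC (by simpa using hca) (hbot c hca) h1)
      (le_of_chainFloor_eq hC (by simpa using hxa) (hbot x hxa) h1.symm)
  have hcard : T.card ≤ a.count c := by
    rw [Multiset.le_count_iff_replicate_le, ← hTc]
    exact hT
  have hsup : b ⊔ T.sup = c := by
    refine le_antisymm (sup_le ?_ ?_) ((Multiset.le_sup hc).trans le_sup_right)
    · rw [← hb c hc]
      exact (chainFloor_lt hC (by simpa using hca) (hbot c hca)).le
    · rw [hTc]
      exact Multiset.sup_le.2 fun x hx => (Multiset.eq_of_mem_replicate hx).le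
  rw [hsup]
  have hbc : chainFloor a.toFinset c = b := hb c hc
  have hlt := chainFloor_lt hC (c := c) (by simpa using hca) (hbot c hca)
  rcases chainFloor_eq_bot_or hC c with h | h
  · have := ha.count_lt c hca
    rw [← hbc, h, hrk.rk_bot]
    omega
  · have := ha.count_add_lt _ (by simpa using h.1) c hca hlt
    rw [← hbc]
    omega

theorem IsFYMultiset.chainWeight_self {rk : L → ℕ} (hrk : IsGeometricRank rk) {a : Multiset L}
    (ha : IsFYMultiset rk a) :
    chainWeight rk a.toFinset (a.map (chainFloor a.toFinset)) a = 1 :=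
  if_pos ⟨rfl, ha.dragonHallRado hrk⟩

omit [OrderBot L] in
theorem Multiset.eq_or_sum_map_lt_of_rel_le {rk : L → ℕ} (hrk : StrictMono rk) {a b : Multiset L}
    (h : Multiset.Rel (· ≤ ·) b a) : b = a ∨ (b.map rk).sum < (a.map rk).sum := by
  induction h with
  | zero => exact Or.inl rfl
  | @cons x y s t hxy hst ih =>
    simp only [Multiset.map_cons, Multiset.sum_cons]
    rcases hxy.eq_or_lt with rfl | hxy
    · rcases ih with rfl | ih
      · exact Or.inl rfl
      · exact Or.inr (by omega)
    · have h1 := hrk hxy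
      rcases ih with rfl | ih
      · exact Or.inr (by omega)
      · exact Or.inr (by omega)

/-- A nonzero weight matches the members of b with those of a floor by floor, and each member of b
lies below its partner. -/
theorem IsFYMultiset.eq_or_lt_of_chainWeight_ne_zero {rk : L → ℕ} (hrk : IsGeometricRank rk)
    {a b : Multiset L} (ha : IsFYMultiset rk a)
    (h : chainWeight rk a.toFinset (a.map (chainFloor a.toFinset)) b ≠ 0) :
    b = a ∨ (b.map rk).sum < (a.map rk).sum := by
  have h1 : b.map (chainFloor a.toFinset) = a.map (chainFloor a.toFinset) := by
    by_contra hne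
    exact h (if_neg fun h => hne h.1)
  refine Multiset.eq_or_sum_map_lt_of_rel_le hrk.strictMono ?_
  have h2 : Multiset.Rel (fun x y => chainFloor a.toFinset x = chainFloor a.toFinset y) b a :=
    Multiset.rel_map.1 (Multiset.rel_eq.2 h1)
  exact h2.mono fun x _ y hy hxy => le_of_chainFloor_eq ha.isChain_toFinset (by simpa using hy)
    (ha.ne_bot hrk hy) hxy

/-- Monomials indexed by Feichtner–Yuzvinsky multisets are linearly independent as soon as there
are functionals that evaluate on them like the dragon Hall–Rado indicators. -/
theorem linearIndependent_of_functionals {rk : L → ℕ} (hrk : IsGeometricRank rk) {A : Type*}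
    [AddCommGroup A] (v : Multiset L → A) (φ : Multiset L → A →ₗ[ℤ] ℤ)
    (hφ : ∀ a b, IsFYMultiset rk a → IsFYMultiset rk b →
      φ a (v b) = chainWeight rk a.toFinset (a.map (chainFloor a.toFinset)) b) :
    LinearIndependent ℤ fun a : {a // IsFYMultiset rk a} => v a.1 := by
  rw [linearIndependent_iff']
  intro s g hg
  by_contra! hcon
  obtain ⟨i, his, hi⟩ := hcon
  -- The functional of a term of least total rank annihilates every other term of the relation.
  obtain ⟨a, has, hmin⟩ := Finset.exists_min_image (s.filter fun i => g i ≠ 0)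
    (fun i => (i.1.map rk).sum) ⟨i, Finset.mem_filter.2 ⟨his, hi⟩⟩
  rw [Finset.mem_filter] at has
  refine has.2 ?_
  have h1 := congrArg (φ a.1) hg
  rw [map_sum, map_zero, Finset.sum_eq_single a] at h1
  · rwa [map_smul, hφ _ _ a.2 a.2, a.2.chainWeight_self hrk, smul_eq_mul, mul_one] at h1
  · intro b hb hba
    rw [map_smul, hφ _ _ a.2 b.2, smul_eq_mul]
    by_contra h0
    have hgb := left_ne_zero_of_mul h0
    rcases a.2.eq_or_lt_of_chainWeight_ne_zero hrk (right_ne_zero_of_mul h0) with h | h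
    · exact hba (Subtype.ext h)
    · exact (hmin b (Finset.mem_filter.2 ⟨hb, hgb⟩)).not_gt h
  · exact fun h => absurd has.1 h

end FYMultiset

/-! ### Functionals on polynomials, and Möbius inversion between the two presentations. -/

section ChowFunctional

variable {L : Type*} [SemilatticeSup L] [OrderBot L]

/-- The linear functional on polynomials with values `chainWeight` on the monomials. -/
noncomputable def chainFunctional (rk : L → ℕ) (C : Finset L) (n : Multiset L) :
    MvPolynomial L ℤ →ₗ[ℤ] ℤ :=
  (MvPolynomial.basisMonomials L ℤ).constr ℤ fun s => chainWeight rk C n (Finsupp.toMultiset s)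

theorem MvPolynomial.monomial_eq_prod_map_X {σ : Type*} (s : σ →₀ ℕ) :
    MvPolynomial.monomial s (1 : ℤ) = ((Finsupp.toMultiset s).map MvPolynomial.X).prod := by
  classical
  rw [MvPolynomial.monomial_eq, Finset.prod_multiset_map_count, Finsupp.toFinset_toMultiset,
    MvPolynomial.C_1, one_mul, Finsupp.prod]
  simp only [Finsupp.count_toMultiset]

theorem chainFunctional_prod_X (rk : L → ℕ) (C : Finset L) (n m : Multiset L) :
    chainFunctional rk C n (m.map MvPolynomial.X).prod = chainWeight rk C n m := by
  classical
  obtain ⟨s, rfl⟩ := Multiset.toFinsupp.symm.surjective m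
  change chainFunctional rk C n ((Finsupp.toMultiset s).map _).prod = _
  rw [← MvPolynomial.monomial_eq_prod_map_X, chainFunctional]
  exact (MvPolynomial.basisMonomials L ℤ).constr_basis ℤ _ s

/-- The largest ideal on which the functional vanishes. -/
noncomputable def chainFunctionalIdeal (rk : L → ℕ) (C : Finset L) (n : Multiset L) :
    Ideal (MvPolynomial L ℤ) where
  carrier := {p | ∀ r, chainFunctional rk C n (r * p) = 0}
  add_mem' := by
    intro p q hp hq r
    rw [mul_add, map_add, hp, hq, add_zero]
  zero_mem' := by
    intro r
    rw [mul_zero, map_zero]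
  smul_mem' := by
    intro c p hp r
    rw [smul_eq_mul, ← mul_assoc]
    exact hp _

theorem mem_chainFunctionalIdeal {rk : L → ℕ} {C : Finset L} {n : Multiset L}
    {p : MvPolynomial L ℤ}
    (h : ∀ m : Multiset L, chainFunctional rk C n ((m.map MvPolynomial.X).prod * p) = 0) :
    p ∈ chainFunctionalIdeal rk C n := by
  intro r
  have : chainFunctional rk C n ∘ₗ LinearMap.mulRight ℤ p = 0 := by
    refine (MvPolynomial.basisMonomials L ℤ).ext fun s => ?_
    simpa [MvPolynomial.monomial_eq_prod_map_X] using h (Finsupp.toMultiset s)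
  exact LinearMap.congr_fun this r

theorem X_mem_chainFunctionalIdeal {rk : L → ℕ} (hrk : IsGeometricRank rk) (C : Finset L)
    (n : Multiset L) {e : L} (he : rk e = 1) :
    MvPolynomial.X e ∈ chainFunctionalIdeal rk C n := by
  refine mem_chainFunctionalIdeal fun m => ?_
  rw [mul_comm, ← Multiset.prod_cons, ← Multiset.map_cons, chainFunctional_prod_X,
    chainWeight_atom hrk C n m he]

theorem quadratic_mem_chainFunctionalIdeal {rk : L → ℕ} (hrk : IsGeometricRank rk) {C : Finset L}
    (hC : IsChain (· ≤ ·) (C : Set L)) (n : Multiset L) (x y : L) :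
    (MvPolynomial.X x - MvPolynomial.X (x ⊔ y)) * (MvPolynomial.X y - MvPolynomial.X (x ⊔ y)) ∈
      chainFunctionalIdeal rk C n := by
  refine mem_chainFunctionalIdeal fun m => ?_
  have h := chainWeight_quadratic hrk hC n m x y
  simp only [← chainFunctional_prod_X, Multiset.map_cons, Multiset.prod_cons] at h
  rw [← map_sub, ← map_sub, ← map_add] at h
  rw [← h]
  congr 1
  ring

open Classical in
/-- Upward Möbius inversion. -/
theorem exists_sum_ge_eq {P R : Type*} [PartialOrder P] [Fintype P] [AddCommGroup R] (f : P → R) :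
    ∃ g : P → R, ∀ x, ∑ y with x ≤ y, g y = f x := by
  let g : P → R := WellFoundedGT.fix fun x ih => f x - ∑ y : {y // x < y}, ih y.1 y.2
  have hg : ∀ x, g x = f x - ∑ y with x < y, g y := by
    intro x
    conv_lhs => rw [show g x = _ from WellFoundedGT.fix_eq _ x]
    congr 1
    exact (Finset.sum_subtype _ (by simp) g).symm
  refine ⟨g, fun x => ?_⟩
  have : (Finset.univ.filter fun y => x ≤ y) = insert x (Finset.univ.filter fun y => x < y) := by
    ext y
    simp [le_iff_eq_or_lt, eq_comm]
  rw [this, Finset.sum_insert (by simp), hg x, sub_add_cancel]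

omit [OrderBot L] in
open Classical in
theorem sub_sup_eq_sum [Fintype L] {R : Type*} [AddCommGroup R] (f g : L → R)
    (hg : ∀ x, ∑ y with x ≤ y, g y = f x) (x y : L) :
    f x - f (x ⊔ y) = ∑ z with x ≤ z ∧ ¬ y ≤ z, g z := by
  rw [← hg x, ← hg (x ⊔ y), sub_eq_iff_eq_add,
    ← Finset.sum_filter_add_sum_filter_not (Finset.univ.filter fun z => x ≤ z) fun z => y ≤ z,
    Finset.filter_filter, Finset.filter_filter, add_comm]
  simp only [sup_le_iff]

-- The product expands over z ≥ x, z ≱ y and w ≥ y, w ≱ x, and any such z and w are incomparable.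
omit [OrderBot L] in
open Classical in
theorem quadratic_eq_zero_of_mul_eq_zero [Fintype L] {R : Type*} [CommRing R] (f g : L → R)
    (hg : ∀ x, ∑ y with x ≤ y, g y = f x)
    (h0 : ∀ x y, ¬ x ≤ y → ¬ y ≤ x → g x * g y = 0) (x y : L) :
    (f x - f (x ⊔ y)) * (f y - f (x ⊔ y)) = 0 := by
  rw [sub_sup_eq_sum f g hg x y, sup_comm, sub_sup_eq_sum f g hg y x, Finset.sum_mul_sum]
  refine Finset.sum_eq_zero fun z hz => Finset.sum_eq_zero fun w hw => ?_
  simp only [Finset.mem_filter, Finset.mem_univ, true_and] at hz hw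
  exact h0 z w (fun h => hw.2 (hz.1.trans h)) (fun h => hz.2 (hw.1.trans h))

omit [OrderBot L] in
open Classical in
/-- If `g` is the upward Möbius inverse of `f`, then the quadratic relations for `f` imply that
`g` multiplies to zero on incomparable pairs. -/
theorem mul_mem_of_not_le [Fintype L] {R : Type*} [CommRing R] (I : Ideal R) (f g : L → R)
    (hg : ∀ x, ∑ y with x ≤ y, g y = f x)
    (hI : ∀ x y, (f x - f (x ⊔ y)) * (f y - f (x ⊔ y)) ∈ I) (x y : L) (hxy : ¬ x ≤ y)
    (hyx : ¬ y ≤ x) : g x * g y ∈ I := by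
  have key : ∀ p : L × L, ¬ p.1 ≤ p.2 → ¬ p.2 ≤ p.1 → g p.1 * g p.2 ∈ I := by
    intro p
    -- In the expanded quadratic relation every term except that of (x, y) belongs to a strictly
    -- larger incomparable pair, so downward induction on pairs isolates g x * g y.
    induction p using WellFoundedGT.induction with
    | ind p ih =>
      obtain ⟨x, y⟩ := p
      intro hxy hyx
      dsimp only at hxy hyx ⊢
      have h := hI x y
      rw [sub_sup_eq_sum f g hg x y, sup_comm, sub_sup_eq_sum f g hg y x, Finset.sum_mul_sum,
        ← Finset.sum_product',
        ← Finset.add_sum_erase _ _ (a := (x, y)) (by simp [hxy, hyx])] at h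
      refine (Ideal.add_mem_iff_left I ?_).1 h
      refine Ideal.sum_mem _ fun q hq => ?_
      simp only [Finset.mem_erase, Finset.mem_product, Finset.mem_filter, Finset.mem_univ,
        true_and] at hq
      obtain ⟨hne, ⟨h1, h2⟩, h3, h4⟩ := hq
      refine ih q (lt_of_le_of_ne ⟨h1, h3⟩ hne.symm) ?_ ?_
      · exact fun h => h4 (h1.trans h)
      · exact fun h => h2 (h3.trans h)
  exact key (x, y) hxy hyx

end ChowFunctional

/-! ### Straightening monomials with the quadratic relations. -/

section Straightening

variable {L : Type*} [SemilatticeSup L] [OrderBot L]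

/-- Climb from x by joining atoms below y. Each step raises the rank by exactly one, so the last
element before y is the required z. -/
theorem IsGeometricRank.exists_coatom {rk : L → ℕ} (hrk : IsGeometricRank rk) {x y : L}
    (hxy : x < y) : ∃ z e, x ≤ z ∧ rk e = 1 ∧ z ⊔ e = y ∧ rk z + 1 = rk y := by
  induction hn : rk y - rk x using Nat.strong_induction_on generalizing x with
  | _ n ih =>
    obtain ⟨e, he, hey, hex⟩ := hrk.exists_atom x y hxy.not_ge
    have h1 : x < x ⊔ e := left_lt_sup.2 hex
    have h2 := hrk.rk_sup_add_le x e ⊥ bot_le bot_le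
    have h3 := hrk.strictMono h1
    have h4 := hrk.strictMono hxy
    rw [hrk.rk_bot] at h2
    rcases (sup_le hxy.le hey).eq_or_lt with h | h
    · refine ⟨x, e, le_rfl, he, h, ?_⟩
      rw [← h]
      omega
    · obtain ⟨z, e', hz, he', hze, hr⟩ := ih (rk y - rk (x ⊔ e)) (by omega) h rfl
      exact ⟨z, e', h1.le.trans hz, he', hze, hr⟩

variable {A : Type*} [CommRing A] {rk : L → ℕ} {h : L → A}

-- With h e = 0 the quadratic relation for z and e reads h y ^ 2 = h y * h z; iterating trades all
-- but one factor h y for h z.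
omit [OrderBot L] in
theorem pow_succ_eq_mul_pow (hatom : ∀ e, rk e = 1 → h e = 0)
    (hquad : ∀ x y, (h x - h (x ⊔ y)) * (h y - h (x ⊔ y)) = 0) {z e y : L} (he : rk e = 1)
    (hzy : z ⊔ e = y) (k : ℕ) : h y ^ (k + 1) = h y * h z ^ k := by
  have h1 := hquad z e
  rw [hzy, hatom e he] at h1
  have h2 : h y * h y = h y * h z := by linear_combination h1
  induction k with
  | zero => simp
  | succ k ih => rw [pow_succ, ih, pow_succ]; linear_combination h z ^ k * h2

/-- Induction on the rank gap: passing to an element z ≥ x covered by y lowers both the gap and the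
exponent by one. -/
theorem mul_pow_rk_sub (hrk : IsGeometricRank rk) (hatom : ∀ e, rk e = 1 → h e = 0)
    (hquad : ∀ x y, (h x - h (x ⊔ y)) * (h y - h (x ⊔ y)) = 0) {x y : L} (hxy : x ≤ y) :
    h x * h y ^ (rk y - rk x) = h y ^ (rk y - rk x + 1) := by
  induction hn : rk y - rk x generalizing y with
  | zero =>
    rcases hxy.eq_or_lt with rfl | hlt
    · simp
    · have := hrk.strictMono hlt
      omega
  | succ n ih =>
    have hlt : x < y := lt_of_le_of_ne hxy (by rintro rfl; omega)
    obtain ⟨z, e, hz, he, hze, hr⟩ := hrk.exists_coatom hlt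
    have h1 := ih hz (by omega)
    rw [pow_succ_eq_mul_pow hatom hquad he hze (n + 1),
      pow_succ_eq_mul_pow hatom hquad he hze n, ← h1]
    ring

/-- The same descent, now ending at an atom, where h vanishes. -/
theorem pow_rk_eq_zero (hrk : IsGeometricRank rk) (hatom : ∀ e, rk e = 1 → h e = 0)
    (hquad : ∀ x y, (h x - h (x ⊔ y)) * (h y - h (x ⊔ y)) = 0) {y : L} (hy : y ≠ ⊥) :
    h y ^ rk y = 0 := by
  induction hn : rk y generalizing y with
  | zero =>
    have := hrk.strictMono (bot_lt_iff_ne_bot.2 hy)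
    omega
  | succ n ih =>
    rcases Nat.eq_zero_or_pos n with rfl | hpos
    · rw [hatom y hn]; simp
    obtain ⟨z, e, -, he, hze, hr⟩ := hrk.exists_coatom (bot_lt_iff_ne_bot.2 hy)
    have hz : z ≠ ⊥ := by
      rintro rfl
      rw [hrk.rk_bot] at hr
      omega
    rw [pow_succ_eq_mul_pow hatom hquad he hze, ih hz (by omega), mul_zero]

open Classical in
/-- Straightening: every monomial is a combination of Feichtner–Yuzvinsky monomials. -/
theorem prod_map_mem_span (hrk : IsGeometricRank rk) {N : ℕ} (hN : ∀ x, rk x ≤ N)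
    (hbot : h ⊥ = 0) (hatom : ∀ e, rk e = 1 → h e = 0)
    (hquad : ∀ x y, (h x - h (x ⊔ y)) * (h y - h (x ⊔ y)) = 0) (m : Multiset L) :
    (m.map h).prod ∈
      Submodule.span ℤ {p | ∃ a, IsFYMultiset rk a ∧ a.card = m.card ∧ (a.map h).prod = p} := by
  have hw : ∀ m : Multiset L, (m.map rk).sum ≤ N * m.card := by
    intro m
    have := Multiset.sum_le_card_nsmul (m.map rk) N (by simpa using fun x _ => hN x)
    simpa [mul_comm] using this
  -- Induction on a bound for the deficit N * card minus total rank: every rewriting preserves the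
  -- cardinality and raises the total rank.
  have key : ∀ k d (m : Multiset L), m.card = d → N * m.card < (m.map rk).sum + k →
      (m.map h).prod ∈
      Submodule.span ℤ {p | ∃ a, IsFYMultiset rk a ∧ a.card = d ∧ (a.map h).prod = p} := by
    intro k
    induction k with
    | zero => intro d m _ hm; exact absurd hm (by simpa using hw m)
    | succ k ih =>
      intro d m hd hm
      by_cases h0 : ⊥ ∈ m
      · rw [Multiset.prod_eq_zero (by simpa using ⟨⊥, h0, hbot⟩)]
        exact Submodule.zero_mem _
      by_cases hinc : ∃ x ∈ m, ∃ y ∈ m, ¬ x ≤ y ∧ ¬ y ≤ x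
      · obtain ⟨x, hx, y, hy, hxy, hyx⟩ := hinc
        obtain ⟨m, rfl⟩ := Multiset.exists_cons_of_mem hx
        have hy' : y ∈ m := by
          rcases Multiset.mem_cons.1 hy with rfl | hy
          · exact absurd le_rfl hxy
          · exact hy
        obtain ⟨m, rfl⟩ := Multiset.exists_cons_of_mem hy'
        have hx1 := hrk.strictMono (left_lt_sup.2 hyx)
        have hy1 := hrk.strictMono (right_lt_sup.2 hxy)
        simp only [Multiset.card_cons, Multiset.map_cons, Multiset.sum_cons] at hd hm
        have e1 := ih d (x ::ₘ (x ⊔ y) ::ₘ m) (by simpa using hd) (by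
          simp only [Multiset.card_cons, Multiset.map_cons, Multiset.sum_cons]; omega)
        have e2 := ih d (y ::ₘ (x ⊔ y) ::ₘ m) (by simpa using hd) (by
          simp only [Multiset.card_cons, Multiset.map_cons, Multiset.sum_cons]; omega)
        have e3 := ih d ((x ⊔ y) ::ₘ (x ⊔ y) ::ₘ m) (by simpa using hd) (by
          simp only [Multiset.card_cons, Multiset.map_cons, Multiset.sum_cons]; omega)
        convert Submodule.sub_mem _ (Submodule.add_mem _ e1 e2) e3 using 1
        simp only [Multiset.map_cons, Multiset.prod_cons]
        linear_combination (m.map h).prod * hquad x y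
      have hchain : IsChain (· ≤ ·) {x | x ∈ m} := by
        intro x hx y hy _
        by_contra hcon
        rw [not_or] at hcon
        exact hinc ⟨x, hx, y, hy, hcon⟩
      by_cases hc : ∀ x ∈ m, m.count x < rk x
      swap
      · push Not at hc
        obtain ⟨x, hx, hxc⟩ := hc
        obtain ⟨m, rfl⟩ := Multiset.le_iff_exists_add.1 (Multiset.le_count_iff_replicate_le.1 hxc)
        rw [Multiset.map_add, Multiset.prod_add, Multiset.map_replicate, Multiset.prod_replicate,
          pow_rk_eq_zero hrk hatom hquad (fun hb => h0 (hb ▸ hx)), zero_mul]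
        exact Submodule.zero_mem _
      by_cases hs : ∀ x ∈ m, ∀ y ∈ m, x < y → m.count y + rk x < rk y
      swap
      · push Not at hs
        obtain ⟨x, hx, y, hy, hxy, hle⟩ := hs
        obtain ⟨m, rfl⟩ := Multiset.exists_cons_of_mem hx
        rw [Multiset.count_cons_of_ne hxy.ne'] at hle
        have hlt := hrk.strictMono hxy
        obtain ⟨m, rfl⟩ := Multiset.le_iff_exists_add.1
          (Multiset.le_count_iff_replicate_le.1 (show rk y - rk x ≤ m.count y by omega))
        -- By `mul_pow_rk_sub` the factor x is absorbed into a further copy of the larger element y.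
        have e := ih d (y ::ₘ (Multiset.replicate (rk y - rk x) y + m)) (by simpa using hd) (by
          simp only [Multiset.card_cons, Multiset.map_cons, Multiset.sum_cons] at hm ⊢; omega)
        convert e using 1
        simp only [Multiset.map_cons, Multiset.prod_cons, Multiset.map_add, Multiset.prod_add,
          Multiset.map_replicate, Multiset.prod_replicate]
        have := mul_pow_rk_sub hrk hatom hquad hxy.le
        linear_combination (m.map h).prod * this
      exact Submodule.subset_span ⟨m, ⟨hchain, hc, hs⟩, hd, rfl⟩
  refine key (N * m.card + 1) _ m rfl (by omega)

end Straightening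

/-! ### The flats of a matroid as a geometric lattice. -/

section MatroidFlats

variable {α : Type*}

/-- The flats of a matroid. -/
abbrev MatroidFlat (M : Matroid α) : Type _ := {F : Set α // M.IsFlat F}

noncomputable instance (M : Matroid α) : SemilatticeSup (MatroidFlat M) where
  sup F G := ⟨M.closure (F.1 ∪ G.1), M.isFlat_closure _⟩
  le_sup_left F G := Set.subset_union_left.trans
    (M.subset_closure _ (Set.union_subset F.2.subset_ground G.2.subset_ground))
  le_sup_right F G := Set.subset_union_right.trans
    (M.subset_closure _ (Set.union_subset F.2.subset_ground G.2.subset_ground))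
  sup_le F G H hF hG := by
    change M.closure (F.1 ∪ G.1) ⊆ H.1
    rw [← H.2.closure]
    exact M.closure_subset_closure (Set.union_subset hF hG)

noncomputable instance (M : Matroid α) : OrderBot (MatroidFlat M) where
  bot := ⟨M.closure ∅, M.isFlat_closure _⟩
  bot_le F := by
    change M.closure ∅ ⊆ F.1
    rw [← F.2.closure]
    exact M.closure_subset_closure (Set.empty_subset _)

/-- The rank of a flat. -/
noncomputable def flatRank (M : Matroid α) (F : MatroidFlat M) : ℕ := (M.eRk F.1).toNat

variable [Finite α] (M : Matroid α)

theorem coe_flatRank (F : MatroidFlat M) : (flatRank M F : ℕ∞) = M.eRk F.1 :=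
  ENat.natCast_toNat ((M.eRk_le_encard F.1).trans_lt (Set.toFinite F.1).encard_lt_top).ne

theorem isGeometricRank_flatRank : IsGeometricRank (flatRank M) where
  rk_bot := by
    have : M.eRk (M.closure ∅) = 0 := by rw [M.eRk_closure_eq, M.eRk_empty]
    change (M.eRk (M.closure ∅)).toNat = 0
    rw [this]; rfl
  strictMono F G hFG := by
    obtain ⟨e, heG, heF⟩ := Set.exists_of_ssubset (show F.1 ⊂ G.1 from hFG)
    have h1 : M.eRk (insert e F.1) = M.eRk F.1 + 1 :=
      M.eRk_insert_eq_add_one ⟨G.2.subset_ground heG, by rwa [F.2.closure]⟩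
    have h2 : M.eRk (insert e F.1) ≤ M.eRk G.1 :=
      M.eRk_mono (Set.insert_subset heG hFG.le)
    rw [h1, ← coe_flatRank, ← coe_flatRank] at h2
    exact_mod_cast h2
  rk_sup_add_le F G H hF hG := by
    have h1 := M.eRk_inter_add_eRk_union_le F.1 G.1
    have h2 : M.eRk H.1 ≤ M.eRk (F.1 ∩ G.1) := M.eRk_mono (Set.subset_inter hF hG)
    have h3 : M.eRk (F ⊔ G).1 = M.eRk (F.1 ∪ G.1) := M.eRk_closure_eq _
    have h4 : M.eRk (F ⊔ G).1 + M.eRk H.1 ≤ M.eRk F.1 + M.eRk G.1 := by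
      rw [h3, add_comm]
      exact (add_le_add_left h2 _).trans h1
    simp only [← coe_flatRank] at h4
    exact_mod_cast h4
  exists_atom F G h := by
    obtain ⟨e, heG, heF⟩ := Set.not_subset.1 h
    have hE := G.2.subset_ground heG
    have he : M.IsNonloop e := by
      rw [← Matroid.not_isLoop_iff]
      exact fun hl => heF (hl.mem_of_isFlat F.2)
    refine ⟨⟨M.closure {e}, M.isFlat_closure _⟩, ?_, ?_, ?_⟩
    · have : M.eRk (M.closure {e}) = 1 := by rw [M.eRk_closure_eq, he.eRk_eq]
      change (M.eRk (M.closure {e})).toNat = 1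
      rw [this]; rfl
    · change M.closure {e} ⊆ G.1
      rw [← G.2.closure]
      exact M.closure_subset_closure (Set.singleton_subset_iff.2 heG)
    · exact fun hle => heF (hle (M.mem_closure_self e))

/-- An atom is the closure of any of its nonloops. This turns the linear relation at i into the
vanishing of the generator at e. -/
theorem exists_isNonloop_of_flatRank_eq_one {e : MatroidFlat M} (he : flatRank M e = 1) :
    ∃ i, M.IsNonloop i ∧ ∀ F : MatroidFlat M, i ∈ F.1 ↔ e ≤ F := by
  have hrk := isGeometricRank_flatRank M
  have hne : ¬ e ≤ ⊥ := by
    intro h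
    rw [le_bot_iff.1 h, hrk.rk_bot] at he
    omega
  obtain ⟨i, hi, hi'⟩ := Set.not_subset.1 hne
  have hnl : M.IsNonloop i := by
    rw [← Matroid.not_isLoop_iff (e.2.subset_ground hi)]
    exact hi'
  refine ⟨i, hnl, fun F => ⟨fun hiF => ?_, fun h => h hi⟩⟩
  by_contra hle
  obtain ⟨a, ha, hae, haF⟩ := hrk.exists_atom F e hle
  let c : MatroidFlat M := ⟨M.closure {i}, M.isFlat_closure _⟩
  have hc : flatRank M c = 1 := by
    have : M.eRk (M.closure {i}) = 1 := by rw [M.eRk_closure_eq, hnl.eRk_eq]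
    change (M.eRk (M.closure {i})).toNat = 1
    rw [this]; rfl
  have hsub : ∀ G : MatroidFlat M, i ∈ G.1 → c ≤ G := by
    intro G hG
    change M.closure {i} ⊆ G.1
    rw [← G.2.closure]
    exact M.closure_subset_closure (Set.singleton_subset_iff.2 hG)
  have hce : c = e := by
    by_contra hne
    have := hrk.strictMono (lt_of_le_of_ne (hsub e hi) hne)
    omega
  exact hle (hce ▸ hsub F hiF)

omit [Finite α] in
theorem exists_flat_of_isNonloop {i : α} (hi : M.IsNonloop i) :
    ∃ e : MatroidFlat M, flatRank M e = 1 ∧ ∀ F : MatroidFlat M, i ∈ F.1 ↔ e ≤ F := by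
  refine ⟨⟨M.closure {i}, M.isFlat_closure _⟩, ?_, fun F => ⟨fun hF => ?_, fun h => ?_⟩⟩
  · have : M.eRk (M.closure {i}) = 1 := by rw [M.eRk_closure_eq, hi.eRk_eq]
    change (M.eRk (M.closure {i})).toNat = 1
    rw [this]; rfl
  · change M.closure {i} ⊆ F.1
    rw [← F.2.closure]
    exact M.closure_subset_closure (Set.singleton_subset_iff.2 hF)
  · exact h (M.mem_closure_self i hi.mem_ground)

end MatroidFlats

/-! ### Powers of a submodule and products of generators. -/

section SubmodulePow

variable {ι R A : Type*} [CommSemiring R] [CommSemiring A] [Algebra R A] {h : ι → A}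

theorem Submodule.prod_map_mem_pow {T : Submodule R A} (hT : ∀ i, h i ∈ T) (m : Multiset ι) :
    (m.map h).prod ∈ T ^ m.card := by
  induction m using Multiset.induction with
  | empty => simpa using Submodule.one_le.1 (le_refl (1 : Submodule R A))
  | cons i m ih =>
    rw [Multiset.map_cons, Multiset.prod_cons, Multiset.card_cons, _root_.pow_succ']
    exact Submodule.mul_mem_mul (hT i) ih

theorem Submodule.span_range_pow_le {S : Submodule R A} {d : ℕ}
    (hS : ∀ m : Multiset ι, m.card = d → (m.map h).prod ∈ S) :
    Submodule.span R (Set.range h) ^ d ≤ S := by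
  induction d generalizing S with
  | zero =>
    rw [_root_.pow_zero, Submodule.one_le]
    simpa using hS 0 rfl
  | succ d ih =>
    rw [_root_.pow_succ']
    refine (mul_le_mul_right (ih (S := Submodule.span R
      {p | ∃ m : Multiset ι, m.card = d ∧ (m.map h).prod = p}) fun m hm =>
        Submodule.subset_span ⟨m, hm, rfl⟩) _).trans ?_
    rw [Submodule.span_mul_span, Submodule.span_le]
    rintro _ ⟨_, ⟨i, rfl⟩, _, ⟨m, hm, rfl⟩, rfl⟩
    simpa using hS (i ::ₘ m) (by simp [hm])

end SubmodulePow

/-! ### The monomial basis of the Chow ring. -/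

section ChowBasis

open Classical

variable {α : Type*} [Finite α] (M : Matroid α)

noncomputable instance : Fintype (MatroidFlat M) := Fintype.ofFinite _

noncomputable instance : Fintype (NonminimalFlat M) := Fintype.ofFinite _

variable {M} in
/-- A nonminimal flat as a flat. -/
def NonminimalFlat.toFlat (F : NonminimalFlat M) : MatroidFlat M := ⟨F.1, F.2.1⟩

omit [Finite α] in
variable {M} in
theorem NonminimalFlat.toFlat_ne_bot (F : NonminimalFlat M) : F.toFlat ≠ ⊥ :=
  fun h => F.2.2 (congrArg Subtype.val h)

theorem sum_nonminimalFlat {R : Type*} [AddCommMonoid R] (g : MatroidFlat M → R)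
    {F : MatroidFlat M} (hF : F ≠ ⊥) :
    ∑ G : NonminimalFlat M with F ≤ G.toFlat, g G.toFlat = ∑ G with F ≤ G, g G := by
  refine Finset.sum_bij (fun G _ => G.toFlat) ?_ ?_ ?_ ?_
  · intro G hG
    simpa using hG
  · intro G _ H _ h
    exact Subtype.ext (congrArg (fun F : MatroidFlat M => F.1) h)
  · intro G hG
    have hG' : F ≤ G := by simpa using hG
    refine ⟨⟨G.1, G.2, fun h => hF ?_⟩, Finset.mem_filter.2 ⟨Finset.mem_univ _, hG'⟩, rfl⟩
    exact le_bot_iff.1 (hG'.trans (le_of_eq (Subtype.ext h)))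
  · intro _ _
    rfl

/-- The sum of the variables above a flat. -/
noncomputable def simplicialPolynomial (F : MatroidFlat M) : MvPolynomial (NonminimalFlat M) ℤ :=
  ∑ G : NonminimalFlat M with F ≤ G.toFlat, MvPolynomial.X G

theorem finsum_X_eq_simplicialPolynomial {i : α} {e : MatroidFlat M}
    (h : ∀ F : MatroidFlat M, i ∈ F.1 ↔ e ≤ F) :
    ∑ᶠ (F : NonminimalFlat M) (_ : i ∈ F.1), (MvPolynomial.X F : MvPolynomial _ ℤ) =
      simplicialPolynomial M e := by
  rw [finsum_eq_sum_of_fintype, simplicialPolynomial, Finset.sum_filter]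
  refine Finset.sum_congr rfl fun F _ => ?_
  rw [finsum_eq_if]
  exact if_congr (h F.toFlat) rfl rfl

/-- The classes of the sums of variables above a flat, with value `0` at the minimal flat. -/
noncomputable def simplicialGenerator (F : MatroidFlat M) : ChowRing M :=
  if F = ⊥ then 0 else Ideal.Quotient.mk (chowIdeal M) (simplicialPolynomial M F)

theorem simplicialGenerator_of_ne {F : MatroidFlat M} (hF : F ≠ ⊥) :
    simplicialGenerator M F = Ideal.Quotient.mk (chowIdeal M) (simplicialPolynomial M F) :=
  if_neg hF

/-- The class of a variable, with value `0` at the minimal flat. -/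
noncomputable def flatClass (F : MatroidFlat M) : ChowRing M :=
  if h : F = ⊥ then 0 else
    Ideal.Quotient.mk (chowIdeal M) (MvPolynomial.X ⟨F.1, F.2, fun h' => h (Subtype.ext h')⟩)

theorem flatClass_toFlat (F : NonminimalFlat M) :
    flatClass M F.toFlat = Ideal.Quotient.mk (chowIdeal M) (MvPolynomial.X F) :=
  dif_neg F.toFlat_ne_bot

theorem sum_flatClass {F : MatroidFlat M} (hF : F ≠ ⊥) :
    ∑ G with F ≤ G, flatClass M G = simplicialGenerator M F := by
  rw [simplicialGenerator_of_ne M hF, simplicialPolynomial, map_sum, ← sum_nonminimalFlat M _ hF]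
  simp only [flatClass_toFlat]

theorem simplicialGenerator_eq_zero (e : MatroidFlat M) (he : flatRank M e = 1) :
    simplicialGenerator M e = 0 := by
  by_cases h : e = ⊥
  · exact if_pos h
  obtain ⟨i, hi, hi'⟩ := exists_isNonloop_of_flatRank_eq_one M he
  rw [simplicialGenerator_of_ne M h, Ideal.Quotient.eq_zero_iff_mem,
    ← finsum_X_eq_simplicialPolynomial M hi']
  exact Ideal.mem_sup_right (Ideal.subset_span ⟨i, hi, rfl⟩)

theorem flatClass_mul_eq_zero (F G : MatroidFlat M) (h : ¬ F ≤ G) (h' : ¬ G ≤ F) :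
    flatClass M F * flatClass M G = 0 := by
  unfold flatClass
  split_ifs with hF hG
  · simp
  · simp
  · simp
  rw [← map_mul, Ideal.Quotient.eq_zero_iff_mem]
  exact Ideal.mem_sup_left (Ideal.subset_span ⟨_, _, h, h', rfl⟩)

theorem simplicialGenerator_quadratic (F G : MatroidFlat M) :
    (simplicialGenerator M F - simplicialGenerator M (F ⊔ G)) *
      (simplicialGenerator M G - simplicialGenerator M (F ⊔ G)) = 0 := by
  -- If one flat is ⊥, the join is the other flat and a factor is zero, so the value chosen at ⊥ is
  -- harmless.
  by_cases hF : F = ⊥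
  · rw [hF, bot_sup_eq, sub_self, mul_zero]
  by_cases hG : G = ⊥
  · rw [hG, sup_bot_eq, sub_self, zero_mul]
  have hFG : F ⊔ G ≠ ⊥ := fun h => hF (sup_eq_bot_iff.1 h).1
  rw [← sum_flatClass M hF, ← sum_flatClass M hG, ← sum_flatClass M hFG]
  exact quadratic_eq_zero_of_mul_eq_zero _ (flatClass M) (fun _ => rfl)
    (flatClass_mul_eq_zero M) F G

/-- The indicator of the dragon Hall–Rado condition descends to the Chow ring. -/
theorem exists_functional {C : Finset (MatroidFlat M)}
    (hC : IsChain (· ≤ ·) (C : Set (MatroidFlat M))) (n : Multiset (MatroidFlat M)) :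
    ∃ φ : ChowRing M →ₗ[ℤ] ℤ, ∀ b, IsFYMultiset (flatRank M) b →
      φ (b.map (simplicialGenerator M)).prod = chainWeight (flatRank M) C n b := by
  have hrk := isGeometricRank_flatRank M
  -- Sending x_F to the Möbius inverse y_F of the variables makes σ carry the sum over G ≥ F of x_G
  -- to the single variable X F.
  obtain ⟨y, hy⟩ := exists_sum_ge_eq (MvPolynomial.X : MatroidFlat M → MvPolynomial _ ℤ)
  let σ : MvPolynomial (NonminimalFlat M) ℤ →ₐ[ℤ] MvPolynomial (MatroidFlat M) ℤ :=
    MvPolynomial.aeval fun F => y F.toFlat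
  have hσ : ∀ F, F ≠ ⊥ → σ (simplicialPolynomial M F) = MvPolynomial.X F := by
    intro F hF
    rw [simplicialPolynomial, map_sum, ← hy, ← sum_nonminimalFlat M _ hF]
    simp [σ]
  have hle : chowIdeal M ≤ (chainFunctionalIdeal (flatRank M) C n).comap σ := by
    refine sup_le (Ideal.span_le.2 ?_) (Ideal.span_le.2 ?_)
    · rintro _ ⟨F, G, hFG, hGF, rfl⟩
      rw [SetLike.mem_coe, Ideal.mem_comap]
      rw [map_mul]
      simp only [σ, MvPolynomial.aeval_X]
      exact mul_mem_of_not_le _ MvPolynomial.X y hy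
        (quadratic_mem_chainFunctionalIdeal hrk hC n) _ _ hFG hGF
    · rintro _ ⟨i, hi, rfl⟩
      rw [SetLike.mem_coe, Ideal.mem_comap]
      obtain ⟨e, he, hie⟩ := exists_flat_of_isNonloop M hi
      rw [finsum_X_eq_simplicialPolynomial M hie, hσ]
      · exact X_mem_chainFunctionalIdeal hrk C n he
      · rintro rfl
        rw [hrk.rk_bot] at he
        omega
  let Φ : MvPolynomial (NonminimalFlat M) ℤ →ₗ[ℤ] ℤ :=
    chainFunctional (flatRank M) C n ∘ₗ σ.toLinearMap
  have hΦ : (chowIdeal M).restrictScalars ℤ ≤ LinearMap.ker Φ := by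
    intro p hp
    have := hle hp 1
    rwa [one_mul] at this
  refine ⟨Submodule.liftQ _ Φ hΦ ∘ₗ
    (Submodule.Quotient.restrictScalarsEquiv ℤ (chowIdeal M)).symm.toLinearMap, fun b hb => ?_⟩
  have hprod : (b.map (simplicialGenerator M)).prod =
      Ideal.Quotient.mk (chowIdeal M) (b.map (simplicialPolynomial M)).prod := by
    rw [map_multiset_prod, Multiset.map_map]
    congr 1
    exact Multiset.map_congr rfl fun F hF => simplicialGenerator_of_ne M (hb.ne_bot hrk hF)
  rw [hprod]
  change chainFunctional (flatRank M) C n (σ (b.map (simplicialPolynomial M)).prod) = _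
  rw [map_multiset_prod, Multiset.map_map, ← chainFunctional_prod_X]
  congr 2
  exact Multiset.map_congr rfl fun F hF => hσ F (hb.ne_bot hrk hF)

theorem linearIndependent_fyMonomial :
    LinearIndependent ℤ fun a : {a // IsFYMultiset (flatRank M) a} =>
      (a.1.map (simplicialGenerator M)).prod := by
  choose φ hφ using fun a : {a // IsFYMultiset (flatRank M) a} =>
    exists_functional M a.2.isChain_toFinset (a.1.map (chainFloor a.1.toFinset))
  refine linearIndependent_of_functionals (isGeometricRank_flatRank M)
    (fun a => (a.map (simplicialGenerator M)).prod)
    (fun a => if ha : IsFYMultiset (flatRank M) a then φ ⟨a, ha⟩ else 0) fun a b ha hb => ?_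
  rw [dif_pos ha]
  convert hφ ⟨a, ha⟩ b hb

/-- The generators are unitriangular in the variables, so the system is solved from the top of the
lattice downwards. -/
theorem flatClass_mem_span (F : MatroidFlat M) :
    flatClass M F ∈ Submodule.span ℤ (Set.range (simplicialGenerator M)) := by
  induction F using WellFoundedGT.induction with
  | ind F ih =>
    by_cases hF : F = ⊥
    · rw [flatClass, dif_pos hF]
      exact Submodule.zero_mem _
    have h1 : ∑ G with F ≤ G, flatClass M G = flatClass M F + ∑ G with F < G, flatClass M G := by
      rw [← Finset.sum_insert (by simp)]
      congr 1
      ext y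
      simp [le_iff_eq_or_lt, eq_comm]
    rw [sum_flatClass M hF] at h1
    rw [← sub_eq_iff_eq_add.2 h1]
    refine Submodule.sub_mem _ (Submodule.subset_span ⟨F, rfl⟩)
      (Submodule.sum_mem _ fun G hG => ih G (by simpa using hG))

theorem chowComponent_eq_pow (d : ℕ) :
    chowComponent M d = Submodule.span ℤ (Set.range fun F : NonminimalFlat M =>
      Ideal.Quotient.mk (chowIdeal M) (MvPolynomial.X F)) ^ d := by
  rw [chowComponent, ← MvPolynomial.homogeneousSubmodule_one_pow,
    MvPolynomial.homogeneousSubmodule_one_eq_span_X, Submodule.map_pow, Submodule.map_span,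
    ← Set.range_comp]
  rfl

theorem chowComponent_eq_span (d : ℕ) :
    chowComponent M d = Submodule.span ℤ
      (Set.range fun a : {a // IsFYMultiset (flatRank M) a ∧ a.card = d} =>
        (a.1.map (simplicialGenerator M)).prod) := by
  have hrk := isGeometricRank_flatRank M
  rw [chowComponent_eq_pow]
  set T := Submodule.span ℤ (Set.range fun F : NonminimalFlat M =>
      Ideal.Quotient.mk (chowIdeal M) (MvPolynomial.X F)) with hT
  apply le_antisymm
  · have h1 : T ≤ Submodule.span ℤ (Set.range (simplicialGenerator M)) := by
      refine Submodule.span_le.2 ?_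
      rintro _ ⟨F, rfl⟩
      dsimp only
      rw [← flatClass_toFlat]
      exact flatClass_mem_span M _
    refine (pow_le_pow_left' h1 d).trans ?_
    refine Submodule.span_range_pow_le fun m hm => ?_
    obtain ⟨N, hN⟩ := (Set.finite_range (flatRank M)).bddAbove
    have h3 := prod_map_mem_span hrk (fun F => hN ⟨F, rfl⟩) (h := simplicialGenerator M) (if_pos rfl)
      (simplicialGenerator_eq_zero M) (simplicialGenerator_quadratic M) m
    refine Submodule.span_mono ?_ h3
    rintro _ ⟨a, ha, hc, rfl⟩
    exact ⟨⟨a, ha, hc.trans hm⟩, rfl⟩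
  · refine Submodule.span_le.2 ?_
    rintro _ ⟨⟨a, ha, rfl⟩, rfl⟩
    dsimp only
    have h1 : ∀ F, simplicialGenerator M F ∈ T := by
      intro F
      by_cases hF : F = ⊥
      · rw [simplicialGenerator, if_pos hF]
        exact Submodule.zero_mem _
      rw [simplicialGenerator_of_ne M hF, simplicialPolynomial, map_sum]
      exact Submodule.sum_mem _ fun G _ => Submodule.subset_span ⟨G, rfl⟩
    exact Submodule.prod_map_mem_pow h1 a

/-- The Feichtner–Yuzvinsky monomials of degree `d` form a basis of the component of degree `d` of
the Chow ring. -/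
theorem nonempty_basis_chowComponent (d : ℕ) :
    Nonempty (Module.Basis {a // IsFYMultiset (flatRank M) a ∧ a.card = d} ℤ
      (chowComponent M d)) := by
  have h := (linearIndependent_fyMonomial M).comp
    (fun a : {a // IsFYMultiset (flatRank M) a ∧ a.card = d} => ⟨a.1, a.2.1⟩)
    (fun a b hab => Subtype.ext (congrArg (fun x => x.1) hab))
  rw [chowComponent_eq_span]
  exact ⟨Module.Basis.span h⟩

theorem isTorsionFree_chowComponent (d : ℕ) : Module.IsTorsionFree ℤ (chowComponent M d) := by
  obtain ⟨b⟩ := nonempty_basis_chowComponent M d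
  have := Module.Free.of_basis b
  exact Module.Free.instIsTorsionFree ℤ _

theorem finrank_chowComponent (d : ℕ) : Module.finrank ℤ (chowComponent M d) =
    Nat.card {a // IsFYMultiset (flatRank M) a ∧ a.card = d} := by
  obtain ⟨b⟩ := nonempty_basis_chowComponent M d
  exact Module.finrank_eq_nat_card_basis b

end ChowBasis

/-! ### Counting the basis: degree and value at -1. -/

section FYCount

open Classical

variable {L : Type*} [SemilatticeSup L] [OrderBot L] {rk : L → ℕ}

theorem Multiset.sup_mem_of_isChain {a : Multiset L} (ha : IsChain (· ≤ ·) {x | x ∈ a})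
    (h0 : a ≠ 0) : a.sup ∈ a := by
  induction a using Multiset.induction with
  | empty => exact absurd rfl h0
  | cons x a ih =>
    rcases eq_or_ne a 0 with rfl | ha0
    · simp
    have hmem := ih (ha.mono fun y hy => Multiset.mem_cons_of_mem hy) ha0
    rw [Multiset.sup_cons]
    rcases ha.total (Multiset.mem_cons_self x a) (Multiset.mem_cons_of_mem hmem) with h | h
    · rw [sup_eq_right.2 h]; exact Multiset.mem_cons_of_mem hmem
    · rw [sup_eq_left.2 h]; exact Multiset.mem_cons_self x a

omit [OrderBot L] in
theorem IsFYMultiset.mono {a b : Multiset L} (ha : IsFYMultiset rk a)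
    (hb : ∀ x ∈ b, x ∈ a) (hcount : ∀ x ∈ b, b.count x = a.count x) : IsFYMultiset rk b where
  isChain := ha.isChain.mono hb
  count_lt x hx := hcount x hx ▸ ha.count_lt x (hb x hx)
  count_add_lt x hx y hy := hcount y hy ▸ ha.count_add_lt x (hb x hx) y (hb y hy)

omit [OrderBot L] in
theorem isFYMultiset_zero : IsFYMultiset rk (0 : Multiset L) where
  isChain := by simp [IsChain]
  count_lt := by simp
  count_add_lt := by simp

theorem IsFYMultiset.sup_eq_bot_iff (hrk : IsGeometricRank rk) {a : Multiset L}
    (ha : IsFYMultiset rk a) : a.sup = ⊥ ↔ a = 0 := by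
  constructor
  · intro h
    by_contra h0
    exact ha.ne_bot hrk (Multiset.sup_mem_of_isChain ha.isChain h0) h
  · rintro rfl
    simp

theorem IsFYMultiset.add_replicate (hrk : IsGeometricRank rk) {b : Multiset L}
    (hb : IsFYMultiset rk b) {x : L} {k : ℕ} (hx : b.sup < x) (hk : k + rk b.sup < rk x) :
    IsFYMultiset rk (b + Multiset.replicate k x) := by
  have hlt : ∀ y ∈ b, y < x := fun y hy => (Multiset.le_sup hy).trans_lt hx
  have hcx : (b + Multiset.replicate k x).count x = k := by
    rw [Multiset.count_add, Multiset.count_replicate_self,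
      Multiset.count_eq_zero.2 fun h => (hlt x h).false, zero_add]
  have hcb : ∀ y ∈ b, (b + Multiset.replicate k x).count y = b.count y := by
    intro y hy
    rw [Multiset.count_add, Multiset.count_replicate, if_neg (hlt y hy).ne', add_zero]
  have hmem : ∀ y ∈ b + Multiset.replicate k x, y ∈ b ∨ y = x := by
    intro y hy
    rcases Multiset.mem_add.1 hy with h | h
    · exact Or.inl h
    · exact Or.inr (Multiset.eq_of_mem_replicate h)
  refine ⟨?_, ?_, ?_⟩
  · intro y hy z hz hyz
    rcases hmem y hy with hy' | rfl <;> rcases hmem z hz with hz' | rfl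
    · exact hb.isChain hy' hz' hyz
    · exact Or.inl (hlt y hy').le
    · exact Or.inr (hlt z hz').le
    · exact absurd rfl hyz
  · intro y hy
    rcases hmem y hy with hy | rfl
    · rw [hcb y hy]; exact hb.count_lt y hy
    · rw [hcx]; omega
  · intro y hy z hz hyz
    rcases hmem z hz with hz' | rfl <;> rcases hmem y hy with hy' | rfl
    · rw [hcb z hz']; exact hb.count_add_lt y hy' z hz' hyz
    · exact absurd hyz (hlt z hz').not_gt
    · rw [hcx]
      have := hrk.strictMono.monotone (Multiset.le_sup hy')
      omega
    · exact absurd hyz (lt_irrefl _)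

omit [OrderBot L] in
theorem IsFYMultiset.filter_ne {a : Multiset L} (ha : IsFYMultiset rk a) (x : L) :
    IsFYMultiset rk (a.filter (· ≠ x)) :=
  ha.mono (fun _ hy => Multiset.mem_of_mem_filter hy)
    fun _ hy => Multiset.count_filter_of_pos (Multiset.mem_filter.1 hy).2

theorem Multiset.filter_ne_add_replicate {β : Type*} (a : Multiset β) (x : β) :
    a.filter (· ≠ x) + Multiset.replicate (a.count x) x = a := by
  rw [← Multiset.filter_eq', add_comm]
  exact Multiset.filter_add_not _ _

theorem IsFYMultiset.sup_filter_ne_lt (hrk : IsGeometricRank rk) {a : Multiset L}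
    (ha : IsFYMultiset rk a) (h0 : a ≠ 0) :
    (a.filter (· ≠ a.sup)).sup < a.sup ∧
      a.count a.sup + rk (a.filter (· ≠ a.sup)).sup < rk a.sup := by
  have hmem := Multiset.sup_mem_of_isChain ha.isChain h0
  rcases eq_or_ne (a.filter (· ≠ a.sup)) 0 with hf | hf
  · rw [hf, Multiset.sup_zero, hrk.rk_bot]
    exact ⟨bot_lt_iff_ne_bot.2 (ha.ne_bot hrk hmem), ha.count_lt _ hmem⟩
  · have h := Multiset.sup_mem_of_isChain (ha.filter_ne a.sup).isChain hf
    rw [Multiset.mem_filter] at h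
    have hlt := lt_of_le_of_ne (Multiset.le_sup h.1) h.2
    exact ⟨hlt, ha.count_add_lt _ h.1 _ hmem hlt⟩

/-- Each multiplicity is smaller than the rank jump below its member, and these jumps telescope to
the rank of the largest member. -/
theorem IsFYMultiset.card_lt (hrk : IsGeometricRank rk) {a : Multiset L}
    (ha : IsFYMultiset rk a) (h0 : a ≠ 0) : a.card < rk a.sup := by
  induction hn : a.card using Nat.strong_induction_on generalizing a with
  | _ n ih =>
    have hmem := Multiset.sup_mem_of_isChain ha.isChain h0
    have hcard := congrArg Multiset.card (Multiset.filter_ne_add_replicate a a.sup)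
    rw [Multiset.card_add, Multiset.card_replicate] at hcard
    have hpos := Multiset.count_pos.2 hmem
    have h1 := (ha.sup_filter_ne_lt hrk h0).2
    rcases eq_or_ne (a.filter (· ≠ a.sup)) 0 with hf | hf
    · rw [hf, Multiset.card_zero] at hcard
      omega
    · have := ih (a.filter (· ≠ a.sup)).card (by omega) (ha.filter_ne _) hf rfl
      omega

variable [Fintype L]

omit [OrderBot L] in
theorem finite_isFYMultiset (rk : L → ℕ) : {a : Multiset L | IsFYMultiset rk a}.Finite := by
  obtain ⟨N, hN⟩ := (Set.finite_range rk).bddAbove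
  have hc : ∀ a : {a : Multiset L // IsFYMultiset rk a}, ∀ x, a.1.count x < N + 1 := by
    intro a x
    by_cases hx : x ∈ a.1
    · have := a.2.count_lt x hx
      have : rk x ≤ N := hN ⟨x, rfl⟩
      omega
    · rw [Multiset.count_eq_zero.2 hx]; omega
  have : Finite {a : Multiset L // IsFYMultiset rk a} := by
    refine Finite.of_injective (β := L → Fin (N + 1)) (fun a x => ⟨a.1.count x, hc a x⟩) ?_
    intro a b hab
    refine Subtype.ext (Multiset.ext.2 fun x => ?_)
    exact congrArg Fin.val (congrFun hab x)
  exact Set.finite_coe_iff.1 this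

/-- The finite set of Feichtner–Yuzvinsky multisets. -/
noncomputable def fyFinset (rk : L → ℕ) : Finset (Multiset L) := (finite_isFYMultiset rk).toFinset

omit [OrderBot L] in
theorem mem_fyFinset {a : Multiset L} : a ∈ fyFinset rk ↔ IsFYMultiset rk a := by
  simp [fyFinset]

/-- The signed count of the Feichtner–Yuzvinsky multisets with a given largest member. -/
noncomputable def signedCount (rk : L → ℕ) (x : L) : ℤ :=
  ∑ a ∈ fyFinset rk with a.sup = x, (-1) ^ a.card

theorem sum_signedCount (rk : L → ℕ) :
    ∑ x, signedCount rk x = ∑ a ∈ fyFinset rk, (-1) ^ a.card :=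
  Finset.sum_fiberwise _ _ _

theorem signedCount_bot (hrk : IsGeometricRank rk) : signedCount rk ⊥ = 1 := by
  have : (fyFinset rk).filter (fun a => a.sup = ⊥) = {0} := by
    ext a
    rw [Finset.mem_filter, mem_fyFinset, Finset.mem_singleton]
    constructor
    · exact fun h => (h.1.sup_eq_bot_iff hrk).1 h.2
    · rintro rfl
      exact ⟨isFYMultiset_zero, Multiset.sup_zero⟩
  rw [signedCount, this, Finset.sum_singleton]
  simp

/-- A multiset with maximum x corresponds to what is left after removing x, with maximum y < x,
together with the multiplicity of x, which runs from 1 to rk x - rk y - 1. -/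
theorem signedCount_eq_sum (hrk : IsGeometricRank rk) {x : L} (hx : x ≠ ⊥) :
    signedCount rk x =
      ∑ y with y < x, signedCount rk y * ∑ k ∈ Finset.Ico 1 (rk x - rk y), (-1) ^ k := by
  have h1 : ∑ y with y < x, signedCount rk y * ∑ k ∈ Finset.Ico 1 (rk x - rk y), (-1 : ℤ) ^ k =
      ∑ b ∈ fyFinset rk with b.sup < x,
        ∑ k ∈ Finset.Ico 1 (rk x - rk b.sup), (-1 : ℤ) ^ (b.card + k) := by
    rw [← Finset.sum_fiberwise_of_maps_to (s := (fyFinset rk).filter fun b => b.sup < x)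
      (t := Finset.univ.filter fun y => y < x) (g := Multiset.sup) (by simp)]
    refine Finset.sum_congr rfl fun y hy => ?_
    rw [Finset.filter_filter, signedCount, Finset.sum_mul]
    have : (fyFinset rk).filter (fun b => b.sup < x ∧ b.sup = y) =
        (fyFinset rk).filter fun b => b.sup = y := by
      refine Finset.filter_congr fun b _ => ⟨And.right, ?_⟩
      rintro rfl
      exact ⟨by simpa using hy, rfl⟩
    rw [this]
    refine Finset.sum_congr rfl fun b hb => ?_
    rw [(Finset.mem_filter.1 hb).2, Finset.mul_sum]
    simp only [pow_add]
  rw [h1, Finset.sum_sigma', signedCount]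
  refine Finset.sum_bij' (fun a _ => ⟨a.filter (· ≠ x), a.count x⟩)
    (fun p _ => p.1 + Multiset.replicate p.2 x) ?_ ?_ ?_ ?_ ?_
  · intro a ha
    rw [Finset.mem_filter, mem_fyFinset] at ha
    obtain ⟨ha, rfl⟩ := ha
    have h0 : a ≠ 0 := fun h => hx ((ha.sup_eq_bot_iff hrk).2 h)
    have h2 := ha.sup_filter_ne_lt hrk h0
    have h3 := Multiset.count_pos.2 (Multiset.sup_mem_of_isChain ha.isChain h0)
    simp only [Finset.mem_sigma, Finset.mem_filter, mem_fyFinset, Finset.mem_Ico]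
    exact ⟨⟨ha.filter_ne _, h2.1⟩, h3, by omega⟩
  · rintro ⟨b, k⟩ hp
    simp only [Finset.mem_sigma, Finset.mem_filter, mem_fyFinset, Finset.mem_Ico] at hp ⊢
    obtain ⟨⟨hb, hbx⟩, hk1, hk⟩ := hp
    refine ⟨hb.add_replicate hrk hbx (by omega), ?_⟩
    rw [Multiset.sup_add]
    refine le_antisymm (sup_le hbx.le ?_) (le_sup_of_le_right ?_)
    · exact Multiset.sup_le.2 fun y hy => (Multiset.eq_of_mem_replicate hy).le
    · exact Multiset.le_sup (Multiset.mem_replicate.2 ⟨by omega, rfl⟩)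
  · intro a _
    exact Multiset.filter_ne_add_replicate a x
  · rintro ⟨b, k⟩ hp
    simp only [Finset.mem_sigma, Finset.mem_filter, mem_fyFinset, Finset.mem_Ico] at hp
    have hne : x ∉ b := fun h => ((Multiset.le_sup h).trans_lt hp.1.2).false
    have e1 : (b + Multiset.replicate k x).filter (· ≠ x) = b := by
      have h1 : b.filter (· ≠ x) = b := Multiset.filter_eq_self.2 fun y hy h => hne (h ▸ hy)
      have h2 : (Multiset.replicate k x).filter (· ≠ x) = 0 :=
        Multiset.filter_eq_nil.2 fun y hy => not_not.2 (Multiset.eq_of_mem_replicate hy)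
      rw [Multiset.filter_add, h1, h2, add_zero]
    have e2 : (b + Multiset.replicate k x).count x = k := by
      rw [Multiset.count_add, Multiset.count_replicate_self, Multiset.count_eq_zero.2 hne, zero_add]
    dsimp only
    rw [e1, e2]
  · intro a _
    have := congrArg Multiset.card (Multiset.filter_ne_add_replicate a x)
    rw [Multiset.card_add, Multiset.card_replicate] at this
    rw [this]

theorem sum_Ico_neg_one_pow (n : ℕ) :
    ∑ k ∈ Finset.Ico 1 (n + 1), (-1 : ℤ) ^ k = if Even n then 0 else -1 := by
  induction n with
  | zero => simp
  | succ n ih =>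
    rw [Finset.sum_Ico_succ_top (by omega), ih, pow_succ]
    by_cases h : Even n
    · rw [if_pos h, if_neg (by simpa [Nat.even_add_one] using h), h.neg_one_pow]; ring
    · rw [if_neg h, if_pos (Nat.even_add_one.2 h), (Nat.not_even_iff_odd.1 h).neg_one_pow]; ring

/-- The alternating sum over multiplicities is -1 when the rank gap is even and 0 when it is odd. -/
theorem signedCount_eq_neg_sum (hrk : IsGeometricRank rk) {x : L} (hx : x ≠ ⊥) :
    signedCount rk x = -∑ y with y < x ∧ (Even (rk x) ↔ Even (rk y)), signedCount rk y := by
  rw [signedCount_eq_sum hrk hx, ← Finset.filter_filter, Finset.sum_filter (fun y => Even _ ↔ _),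
    ← Finset.sum_neg_distrib]
  refine Finset.sum_congr rfl fun y hy => ?_
  have hlt := hrk.strictMono (Finset.mem_filter.1 hy).2
  obtain ⟨n, hn⟩ : ∃ n, rk x = rk y + (n + 1) := ⟨rk x - rk y - 1, by omega⟩
  rw [hn, Nat.add_sub_cancel_left, sum_Ico_neg_one_pow]
  simp only [Nat.even_add_one, Nat.even_add]
  by_cases h1 : Even n <;> by_cases h2 : Even (rk y) <;> simp [h1, h2]

/-- The recursion stays within odd ranks and never reaches ⊥, where the only nonzero initial value
sits. -/
theorem signedCount_eq_zero_of_odd (hrk : IsGeometricRank rk) {x : L} (hx : Odd (rk x)) :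
    signedCount rk x = 0 := by
  induction x using WellFoundedLT.induction with
  | ind x ih =>
    have hb : x ≠ ⊥ := by
      rintro rfl
      rw [hrk.rk_bot] at hx
      exact absurd hx (by decide)
    rw [signedCount_eq_neg_sum hrk hb, neg_eq_zero]
    refine Finset.sum_eq_zero fun y hy => ?_
    obtain ⟨h1, h2⟩ := (Finset.mem_filter.1 hy).2
    exact ih y h1 (by rw [← Nat.not_even_iff_odd] at hx ⊢; rwa [← h2])

/-- With value 1 at ⊥, this says that the signed counts are the Möbius function from ⊥ of the
subposet of even ranks. -/
theorem sum_signedCount_le_eq_zero (hrk : IsGeometricRank rk) {x : L} (hx : x ≠ ⊥)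
    (he : Even (rk x)) : ∑ y with y ≤ x ∧ Even (rk y), signedCount rk y = 0 := by
  have h : (Finset.univ.filter fun y => y ≤ x ∧ Even (rk y)) =
      insert x (Finset.univ.filter fun y => y < x ∧ (Even (rk x) ↔ Even (rk y))) := by
    ext y
    simp only [Finset.mem_filter, Finset.mem_univ, true_and, Finset.mem_insert, he, true_iff]
    rw [le_iff_eq_or_lt]
    constructor
    · rintro ⟨rfl | h1, h2⟩
      · exact Or.inl rfl
      · exact Or.inr ⟨h1, h2⟩
    · rintro (rfl | ⟨h1, h2⟩)
      · exact ⟨Or.inl rfl, he⟩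
      · exact ⟨Or.inr h1, h2⟩
  rw [h, Finset.sum_insert (by simp), signedCount_eq_neg_sum hrk hx, neg_add_cancel]

/-- If the number of elements of each even rank below an element of even rank depends on the two
ranks only, then the signed counts are the solution of the corresponding recursion. -/
theorem signedCount_eq_of_recursion (hrk : IsGeometricRank rk) {r : ℕ} (c : ℕ → ℕ → ℚ)
    (e : ℕ → ℚ) (hc : ∀ x, rk x < r → ∀ j, ((Finset.univ.filter fun y => y ≤ x ∧ rk y = j).card : ℚ)
      = c (rk x) j)
    (hc1 : ∀ k, c k k = 1) (he0 : e 0 = 1)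
    (he : ∀ k, 0 < k → 2 * k < r → ∑ j ∈ Finset.range (k + 1), c (2 * k) (2 * j) * e j = 0)
    {x : L} {k : ℕ} (hx : rk x = 2 * k) (hr : rk x < r) : (signedCount rk x : ℚ) = e k := by
  induction k using Nat.strong_induction_on generalizing x with
  | _ k ih =>
    rcases Nat.eq_zero_or_pos k with rfl | hk
    · have : x = ⊥ := by
        by_contra h
        have := hrk.strictMono (bot_lt_iff_ne_bot.2 h)
        omega
      rw [this, signedCount_bot hrk, he0, Int.cast_one]
    have hb : x ≠ ⊥ := by
      rintro rfl
      rw [hrk.rk_bot] at hx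
      omega
    have h1 := sum_signedCount_le_eq_zero hrk hb (by rw [hx]; exact even_two_mul k)
    have h2 : ∑ y with y ≤ x ∧ Even (rk y), (signedCount rk y : ℚ) =
        ∑ j ∈ Finset.range (k + 1), ∑ y with y ≤ x ∧ rk y = 2 * j, (signedCount rk y : ℚ) := by
      rw [← Finset.sum_fiberwise_of_maps_to
        (s := Finset.univ.filter fun y => y ≤ x ∧ Even (rk y)) (g := fun y => rk y / 2)
        (t := Finset.range (k + 1))]
      · refine Finset.sum_congr rfl fun j _ => Finset.sum_congr ?_ fun _ _ => rfl
        rw [Finset.filter_filter]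
        refine Finset.filter_congr fun y _ => ?_
        rw [and_assoc]
        refine and_congr_right fun _ => ?_
        rw [Nat.even_iff]
        omega
      · intro y hy
        have := hrk.strictMono.monotone (Finset.mem_filter.1 hy).2.1
        rw [Finset.mem_range]
        omega
    have h3 : ∀ j ∈ Finset.range k, ∑ y with y ≤ x ∧ rk y = 2 * j, (signedCount rk y : ℚ) =
        c (2 * k) (2 * j) * e j := by
      intro j hj
      have hjk := Finset.mem_range.1 hj
      rw [Finset.sum_congr rfl fun y hy => ih j hjk (Finset.mem_filter.1 hy).2.2
        (by rw [(Finset.mem_filter.1 hy).2.2]; omega), Finset.sum_const, nsmul_eq_mul, hc x hr, hx]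
    have h4 : (Finset.univ.filter fun y => y ≤ x ∧ rk y = 2 * k) = {x} := by
      ext y
      simp only [Finset.mem_filter, Finset.mem_univ, true_and, Finset.mem_singleton]
      constructor
      · rintro ⟨h1, h2⟩
        by_contra hne
        have := hrk.strictMono (lt_of_le_of_ne h1 hne)
        omega
      · rintro rfl
        exact ⟨le_rfl, hx⟩
    have h5 : ∑ y with y ≤ x ∧ Even (rk y), (signedCount rk y : ℚ) = 0 := by exact_mod_cast h1
    have h6 := he k hk (by omega)
    rw [h2, Finset.sum_range_succ, Finset.sum_congr rfl h3, h4, Finset.sum_singleton] at h5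
    rw [Finset.sum_range_succ, hc1, one_mul] at h6
    linarith

/-- The Hilbert polynomial as a sum over Feichtner–Yuzvinsky multisets. -/
noncomputable def fyPolynomial (rk : L → ℕ) : Polynomial ℤ :=
  ∑ a ∈ fyFinset rk, Polynomial.X ^ a.card

omit [OrderBot L] in
theorem coeff_fyPolynomial (rk : L → ℕ) (d : ℕ) :
    (fyPolynomial rk).coeff d = Nat.card {a // IsFYMultiset rk a ∧ a.card = d} := by
  rw [fyPolynomial, Polynomial.finsetSum_coeff]
  simp only [Polynomial.coeff_X_pow]
  rw [Finset.sum_boole, ← Nat.card_eq_finsetCard]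
  congr 1
  refine Nat.card_congr (Equiv.subtypeEquivRight fun a => ?_)
  rw [Finset.mem_filter, mem_fyFinset, eq_comm]

theorem degree_fyPolynomial (hrk : IsGeometricRank rk) {r : ℕ} (hr : 0 < r) (hle : ∀ x, rk x ≤ r)
    {t : L} (ht : rk t = r) : (fyPolynomial rk).degree = ((r - 1 : ℕ) : WithBot ℕ) := by
  have hcard : ∀ a, IsFYMultiset rk a → a.card ≤ r - 1 := by
    intro a ha
    rcases eq_or_ne a 0 with rfl | h0
    · simp
    · have := ha.card_lt hrk h0
      have := hle a.sup
      omega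
  apply le_antisymm
  · rw [Polynomial.degree_le_iff_coeff_zero]
    intro m hm
    rw [coeff_fyPolynomial, Nat.cast_eq_zero, Nat.card_eq_zero]
    left
    refine ⟨fun a => ?_⟩
    have := hcard a.1 a.2.1
    have h2 := a.2.2
    have h3 : r - 1 < m := by exact_mod_cast hm
    omega
  · refine Polynomial.le_degree_of_ne_zero ?_
    rw [coeff_fyPolynomial, Nat.cast_ne_zero]
    -- The top degree is attained by r - 1 copies of an element of rank r.
    have hfy : IsFYMultiset rk (Multiset.replicate (r - 1) t) := by
      have := (isFYMultiset_zero (rk := rk)).add_replicate hrk (x := t) (k := r - 1)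
        (by
          rw [Multiset.sup_zero, bot_lt_iff_ne_bot]
          rintro rfl
          rw [hrk.rk_bot] at ht
          omega)
        (by rw [Multiset.sup_zero, hrk.rk_bot]; omega)
      rwa [zero_add] at this
    have : Finite {a // IsFYMultiset rk a ∧ a.card = r - 1} :=
      ((finite_isFYMultiset rk).subset fun a ha => ha.1).to_subtype
    have : Nonempty {a // IsFYMultiset rk a ∧ a.card = r - 1} :=
      ⟨⟨_, hfy, Multiset.card_replicate _ _⟩⟩
    exact Nat.card_pos.ne'

theorem eval_fyPolynomial (rk : L → ℕ) :
    (fyPolynomial rk).eval (-1) = ∑ x, signedCount rk x := by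
  rw [sum_signedCount, fyPolynomial, Polynomial.eval_finsetSum]
  simp

/-- The value of the Hilbert polynomial at `-1` for a lattice of odd rank. -/
theorem eval_fyPolynomial_of_recursion (hrk : IsGeometricRank rk) {r : ℕ} (hr : Odd r)
    (hle : ∀ x, rk x ≤ r) (w : ℕ → ℚ) (c : ℕ → ℕ → ℚ) (e : ℕ → ℚ)
    (hw : ∀ j < r, ((Finset.univ.filter fun y => rk y = j).card : ℚ) = w j)
    (hc : ∀ x, rk x < r → ∀ j, ((Finset.univ.filter fun y => y ≤ x ∧ rk y = j).card : ℚ)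
      = c (rk x) j)
    (hc1 : ∀ k, c k k = 1) (he0 : e 0 = 1)
    (he : ∀ k, 0 < k → 2 * k < r → ∑ j ∈ Finset.range (k + 1), c (2 * k) (2 * j) * e j = 0) :
    (((fyPolynomial rk).eval (-1) : ℤ) : ℚ) =
      ∑ k ∈ Finset.range ((r - 1) / 2 + 1), w (2 * k) * e k := by
  have hodd : r % 2 = 1 := Nat.odd_iff.1 hr
  -- Odd ranks, in particular r itself, drop out, so counts are needed only in ranks below r.
  rw [eval_fyPolynomial, Int.cast_sum, ← Finset.sum_filter_add_sum_filter_not Finset.univ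
    (fun x => Even (rk x)), Finset.sum_eq_zero (s := Finset.univ.filter fun x => ¬ Even (rk x)),
    add_zero, ← Finset.sum_fiberwise_of_maps_to (g := fun y => rk y / 2)
        (t := Finset.range ((r - 1) / 2 + 1))]
  · refine Finset.sum_congr rfl fun k hk => ?_
    have hk' := Finset.mem_range.1 hk
    rw [Finset.filter_filter]
    have h1 : (Finset.univ.filter fun x => Even (rk x) ∧ rk x / 2 = k) =
        Finset.univ.filter fun x => rk x = 2 * k := by
      refine Finset.filter_congr fun y _ => ?_
      rw [Nat.even_iff]
      omega
    rw [h1, Finset.sum_congr rfl fun y hy => signedCount_eq_of_recursion hrk c e hc hc1 he0 he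
      (Finset.mem_filter.1 hy).2 (by rw [(Finset.mem_filter.1 hy).2]; omega), Finset.sum_const,
      nsmul_eq_mul, hw _ (by omega)]
  · intro y _
    have := hle y
    rw [Finset.mem_range]
    omega
  · intro x hx
    rw [signedCount_eq_zero_of_odd hrk (Nat.not_even_iff_odd.1 (Finset.mem_filter.1 hx).2),
      Int.cast_zero]

end FYCount

/-! ### Gaussian binomials count subspaces. -/

section GaussianBinomial

theorem qInt_mul_sub_one (q : ℚ) (n : ℕ) : qInt q n * (q - 1) = q ^ n - 1 := geom_sum_mul q n

theorem qInt_pos {q : ℚ} (hq : 0 ≤ q) (n : ℕ) : 0 < qInt q (n + 1) := by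
  rw [qInt, Finset.sum_range_succ']
  have : 0 ≤ ∑ i ∈ Finset.range n, q ^ (i + 1) := Finset.sum_nonneg fun i _ => pow_nonneg hq _
  rw [pow_zero]
  linarith

theorem qFactorial_pos {q : ℚ} (hq : 0 ≤ q) (n : ℕ) : 0 < qFactorial q n :=
  Finset.prod_pos fun i _ => qInt_pos hq i

theorem qFactorial_succ (q : ℚ) (n : ℕ) :
    qFactorial q (n + 1) = qFactorial q n * qInt q (n + 1) := Finset.prod_range_succ _ _

/-- This rests on q^m - q^i = q^i (q - 1) [m - i]_q, kept free of division. -/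
theorem qFactorial_sub_mul_prod (q : ℚ) {m j : ℕ} (hj : j ≤ m) :
    qFactorial q (m - j) * ∏ i ∈ Finset.range j, (q ^ m - q ^ i) =
      qFactorial q m * ∏ i ∈ Finset.range j, (q ^ i * (q - 1)) := by
  induction j with
  | zero => simp
  | succ j ih =>
    have h1 := ih (by omega)
    obtain ⟨d, rfl⟩ := Nat.exists_eq_add_of_le hj
    rw [show j + 1 + d - j = d + 1 by omega, qFactorial_succ] at h1
    rw [show j + 1 + d - (j + 1) = d by omega, Finset.prod_range_succ, Finset.prod_range_succ,
      ← mul_assoc (qFactorial q (j + 1 + d)), ← h1]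
    have h2 : q ^ (j + 1 + d) - q ^ j = q ^ j * (qInt q (d + 1) * (q - 1)) := by
      rw [qInt_mul_sub_one]; ring
    rw [h2]
    ring

theorem qBinomial_mul_prod {q : ℚ} (hq : 1 < q) {m j : ℕ} (hj : j ≤ m) :
    qBinomial q m j * ∏ i ∈ Finset.range j, (q ^ j - q ^ i) =
      ∏ i ∈ Finset.range j, (q ^ m - q ^ i) := by
  have h1 := qFactorial_sub_mul_prod q hj
  have h2 := qFactorial_sub_mul_prod q (le_refl j)
  have h0 : 0 ≤ q := by linarith
  have hpos := (qFactorial_pos h0 (m - j)).ne'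
  have hpos' := (qFactorial_pos h0 j).ne'
  rw [Nat.sub_self, show qFactorial q 0 = 1 by simp [qFactorial], one_mul] at h2
  rw [qBinomial, if_pos hj, h2]
  apply mul_left_cancel₀ hpos
  rw [h1]
  generalize ∏ i ∈ Finset.range j, q ^ i * (q - 1) = Q
  field_simp

theorem qBinomial_self {q : ℚ} (hq : 0 ≤ q) (m : ℕ) : qBinomial q m m = 1 := by
  have h := (qFactorial_pos hq m).ne'
  rw [qBinomial, if_pos le_rfl, Nat.sub_self, show qFactorial q 0 = 1 by simp [qFactorial], mul_one,
    div_self h]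

variable {K V : Type*} [Field K] [Fintype K] [AddCommGroup V] [Module K V] [Finite V]

/-- Independent families spanning `W` are independent families in `W` of full length. -/
def linearIndependentSpanEquiv (j : ℕ) (W : Submodule K V) (hW : Module.finrank K W = j) :
    {s : {s : Fin j → V // LinearIndependent K s} // Submodule.span K (Set.range s.1) = W} ≃
      {t : Fin j → W // LinearIndependent K t} where
  toFun s := ⟨fun i => ⟨s.1.1 i, s.2.le (Submodule.subset_span ⟨i, rfl⟩)⟩,
    LinearIndependent.of_comp W.subtype s.1.2⟩
  invFun t := ⟨⟨fun i => (t.1 i : V), t.2.map' W.subtype W.ker_subtype⟩, by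
    have h : Submodule.span K (Set.range t.1) = ⊤ :=
      t.2.span_eq_top_of_card_eq_finrank' (by simp [hW])
    have h2 : Set.range (fun i => (t.1 i : V)) = W.subtype '' Set.range t.1 := by
      rw [← Set.range_comp]; rfl
    change Submodule.span K (Set.range fun i => (t.1 i : V)) = W
    rw [h2, ← Submodule.map_span, h, Submodule.map_subtype_top]⟩
  left_inv _ := rfl
  right_inv _ := rfl

/-- Sort the independent j-tuples of V by their span: each subspace of dimension j receives as many
as it has ordered bases. -/
theorem card_submodule_finrank_eq (j : ℕ) :
    (Nat.card {W : Submodule K V // Module.finrank K W = j} : ℚ) =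
      qBinomial (Fintype.card K) (Module.finrank K V) j := by
  classical
  have : Module.Finite K V := Module.Finite.of_finite
  by_cases hj : j ≤ Module.finrank K V
  swap
  · rw [qBinomial, if_neg hj, Nat.cast_eq_zero, Nat.card_eq_zero]
    exact Or.inl ⟨fun W => hj (W.2 ▸ Submodule.finrank_le W.1)⟩
  have hq : (1 : ℚ) < Fintype.card K := by exact_mod_cast Fintype.one_lt_card
  have hcast : ∀ m, j ≤ m → ((∏ i : Fin j, (Fintype.card K ^ m - Fintype.card K ^ i.val) : ℕ) : ℚ) =
      ∏ i ∈ Finset.range j, ((Fintype.card K : ℚ) ^ m - (Fintype.card K : ℚ) ^ i) := by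
    intro m hm
    rw [Fin.prod_univ_eq_prod_range (fun i => Fintype.card K ^ m - Fintype.card K ^ i),
      Nat.cast_prod]
    refine Finset.prod_congr rfl fun i hi => ?_
    have := Finset.mem_range.1 hi
    rw [Nat.cast_sub (Nat.pow_le_pow_right Fintype.card_pos (by omega)), Nat.cast_pow, Nat.cast_pow]
  have hspan : ∀ s : {s : Fin j → V // LinearIndependent K s},
      Module.finrank K (Submodule.span K (Set.range s.1)) = j := by
    intro s
    rw [finrank_span_eq_card s.2, Fintype.card_fin]
  let f : {s : Fin j → V // LinearIndependent K s} → {W : Submodule K V // Module.finrank K W = j} :=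
    fun s => ⟨_, hspan s⟩
  have h1 : Nat.card {s : Fin j → V // LinearIndependent K s} =
      Nat.card {W : Submodule K V // Module.finrank K W = j} *
        ∏ i : Fin j, (Fintype.card K ^ j - Fintype.card K ^ i.val) := by
    have := Fintype.ofFinite {W : Submodule K V // Module.finrank K W = j}
    rw [← Nat.card_congr (Equiv.sigmaFiberEquiv f), Nat.card_sigma,
      Finset.sum_congr rfl fun W _ => ?_, Finset.sum_const, Finset.card_univ,
      Nat.card_eq_fintype_card, smul_eq_mul]
    have hW := card_linearIndependent (K := K) (V := W.1) (k := j) W.2.ge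
    rw [W.2] at hW
    rw [← hW]
    refine Nat.card_congr ((Equiv.subtypeEquivRight fun s => ?_).trans
      (linearIndependentSpanEquiv j W.1 W.2))
    exact Subtype.ext_iff
  rw [card_linearIndependent hj] at h1
  have h2 := congrArg (Nat.cast : ℕ → ℚ) h1
  rw [Nat.cast_mul, hcast _ hj, hcast _ le_rfl, ← qBinomial_mul_prod hq hj] at h2
  refine (mul_right_cancel₀ ?_ h2).symm
  refine Finset.prod_ne_zero_iff.2 fun i hi => sub_ne_zero.2 ?_
  exact (pow_lt_pow_right₀ hq (Finset.mem_range.1 hi)).ne'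

end GaussianBinomial

/-! ### Flats of the truncated vector space matroid. -/

section VectorSpaceMatroid

variable {F : Type*} [Field F] {n r : ℕ}

section

variable [Finite F]

theorem vectorSpaceMatroid_indep_iff {I : Set (Fin n → F)} :
    (vectorSpaceMatroid F n r).Indep I ↔ LinearIndepOn F id I ∧ I.ncard ≤ r := Iff.rfl

theorem vectorSpaceMatroid_ground : (vectorSpaceMatroid F n r).E = Set.univ := rfl

theorem flatRank_vectorSpaceMatroid_le (S : MatroidFlat (vectorSpaceMatroid F n r)) :
    flatRank _ S ≤ r := by
  have h : (vectorSpaceMatroid F n r).eRk S.1 ≤ r := by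
    rw [Matroid.eRk_le_iff]
    intro I _ hI
    rw [← (Set.toFinite I).cast_ncard_eq]
    exact_mod_cast (vectorSpaceMatroid_indep_iff.1 hI).2
  rw [← coe_flatRank] at h
  exact_mod_cast h

theorem exists_flatRank_vectorSpaceMatroid_eq (hrn : r ≤ n) :
    ∃ S : MatroidFlat (vectorSpaceMatroid F n r), flatRank _ S = r := by
  refine ⟨⟨_, (vectorSpaceMatroid F n r).ground_isFlat⟩, le_antisymm
    (flatRank_vectorSpaceMatroid_le _) ?_⟩
  have hli : LinearIndependent F fun i : Fin r => Pi.basisFun F (Fin n) (Fin.castLE hrn i) :=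
    (Pi.basisFun F (Fin n)).linearIndependent.comp _ (Fin.castLE_injective hrn)
  have hcard : (Set.range fun i : Fin r => Pi.basisFun F (Fin n) (Fin.castLE hrn i)).ncard = r := by
    rw [← Nat.card_coe_set_eq, Nat.card_range_of_injective hli.injective, Nat.card_fin]
  have h : (r : ℕ∞) ≤ (vectorSpaceMatroid F n r).eRk (vectorSpaceMatroid F n r).E := by
    refine Matroid.le_eRk_iff.2 ⟨_, Set.subset_univ _,
      vectorSpaceMatroid_indep_iff.2 ⟨hli.linearIndepOn_id, hcard.le⟩, ?_⟩
    rw [← (Set.toFinite _).cast_ncard_eq, hcard]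
  have h2 := coe_flatRank (vectorSpaceMatroid F n r)
    ⟨_, (vectorSpaceMatroid F n r).ground_isFlat⟩
  rw [← h2] at h
  exact_mod_cast h

/-- Strictness of the size bound leaves room for one more vector, so the truncation at r does not
interfere. -/
theorem vectorSpaceMatroid_closure {I : Set (Fin n → F)} (hI : LinearIndepOn F id I)
    (hr : I.ncard < r) :
    (vectorSpaceMatroid F n r).closure I = (Submodule.span F I : Set (Fin n → F)) := by
  have hind : (vectorSpaceMatroid F n r).Indep I := vectorSpaceMatroid_indep_iff.2 ⟨hI, hr.le⟩
  ext e
  rw [hind.mem_closure_iff']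
  simp only [vectorSpaceMatroid_ground, Set.mem_univ, true_and, SetLike.mem_coe]
  constructor
  · intro h
    by_contra he
    have heI : e ∉ I := fun h => he (Submodule.subset_span h)
    refine heI (h (vectorSpaceMatroid_indep_iff.2 ⟨hI.id_insert he, ?_⟩))
    rw [Set.ncard_insert_of_notMem heI (Set.toFinite _)]
    omega
  · intro he h
    by_contra heI
    have := (vectorSpaceMatroid_indep_iff.1 h).1
    rw [linearIndepOn_id_insert heI] at this
    exact this.2 he

theorem finrank_span_eq_ncard {I : Set (Fin n → F)} (hI : LinearIndepOn F id I) :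
    Module.finrank F (Submodule.span F I) = I.ncard := by
  have := Fintype.ofFinite I
  rw [finrank_span_set_eq_card hI, Set.ncard_eq_toFinset_card']

/-- Flats of non-maximal rank are subspaces. -/
theorem exists_submodule_of_flatRank_lt {S : MatroidFlat (vectorSpaceMatroid F n r)}
    (hS : flatRank _ S < r) :
    ∃ W : Submodule F (Fin n → F), (W : Set (Fin n → F)) = S.1 ∧
      Module.finrank F W = flatRank _ S := by
  obtain ⟨I, hI⟩ := (vectorSpaceMatroid F n r).exists_isBasis S.1 S.2.subset_ground
  have hind := vectorSpaceMatroid_indep_iff.1 hI.indep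
  have hcard : I.ncard = flatRank _ S := by
    have h := hI.encard_eq_eRk
    rw [← coe_flatRank, ← (Set.toFinite I).cast_ncard_eq] at h
    exact_mod_cast h
  refine ⟨Submodule.span F I, ?_, (finrank_span_eq_ncard hind.1).trans hcard⟩
  rw [← vectorSpaceMatroid_closure (r := r) hind.1 (hcard ▸ hS), hI.closure_eq_closure,
    S.2.closure]

theorem exists_flat_of_finrank_lt {W : Submodule F (Fin n → F)} (hW : Module.finrank F W < r) :
    ∃ S : MatroidFlat (vectorSpaceMatroid F n r), (W : Set (Fin n → F)) = S.1 ∧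
      Module.finrank F W = flatRank _ S := by
  obtain ⟨I, hIW, hspan, hI⟩ := exists_linearIndependent F (W : Set (Fin n → F))
  rw [Submodule.span_eq] at hspan
  have hI' : LinearIndepOn F id I := hI
  have hcard : Module.finrank F W = I.ncard := by rw [← hspan, finrank_span_eq_ncard hI']
  have hcl := vectorSpaceMatroid_closure (r := r) hI' (hcard ▸ hW)
  have hind : (vectorSpaceMatroid F n r).Indep I :=
    vectorSpaceMatroid_indep_iff.2 ⟨hI', by omega⟩
  refine ⟨⟨_, (vectorSpaceMatroid F n r).isFlat_closure I⟩, by rw [← hspan]; exact hcl.symm, ?_⟩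
  have h := coe_flatRank (vectorSpaceMatroid F n r)
    ⟨_, (vectorSpaceMatroid F n r).isFlat_closure I⟩
  rw [Matroid.eRk_closure_eq, hind.eRk_eq_encard, ← (Set.toFinite I).cast_ncard_eq] at h
  rw [hcard]
  exact_mod_cast h.symm

-- The predicate P lets one bijection serve both for all flats of rank j and for those below a given
-- flat.
open Classical in
theorem card_flatRank_eq {j : ℕ} (hj : j < r)
    (P : Set (Fin n → F) → Prop) :
    (Finset.univ.filter fun S : MatroidFlat (vectorSpaceMatroid F n r) =>
      P S.1 ∧ flatRank _ S = j).card =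
    Nat.card {W : Submodule F (Fin n → F) // P W ∧ Module.finrank F W = j} := by
  have hex : ∀ W : {W : Submodule F (Fin n → F) // P W ∧ Module.finrank F W = j},
      ∃ S : MatroidFlat (vectorSpaceMatroid F n r), (W.1 : Set (Fin n → F)) = S.1 ∧
        Module.finrank F W.1 = flatRank _ S :=
    fun W => exists_flat_of_finrank_lt (by rw [W.2.2]; exact hj)
  choose g hg hg' using hex
  rw [← Nat.card_eq_finsetCard]
  have hmem : ∀ W, g W ∈ Finset.univ.filter fun S : MatroidFlat (vectorSpaceMatroid F n r) =>
      P S.1 ∧ flatRank _ S = j := by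
    intro W
    rw [Finset.mem_filter]
    exact ⟨Finset.mem_univ _, hg W ▸ W.2.1, (hg' W).symm.trans W.2.2⟩
  refine (Nat.card_eq_of_bijective (fun W => ⟨g W, hmem W⟩) ⟨?_, ?_⟩).symm
  · intro W W' h
    have h1 : g W = g W' := congrArg Subtype.val h
    refine Subtype.ext (SetLike.coe_injective ?_)
    rw [hg, hg, h1]
  · rintro ⟨S, hS⟩
    rw [Finset.mem_filter] at hS
    obtain ⟨W, hW, hW'⟩ := exists_submodule_of_flatRank_lt (S := S) (by rw [hS.2.2]; exact hj)
    refine ⟨⟨W, hW ▸ hS.2.1, hW'.trans hS.2.2⟩, Subtype.ext (Subtype.ext ?_)⟩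
    rw [← hg, hW]

end

open Classical in
theorem card_flatRank_eq_qBinomial [Fintype F] {j : ℕ} (hj : j < r) :
    ((Finset.univ.filter fun S : MatroidFlat (vectorSpaceMatroid F n r) =>
      flatRank _ S = j).card : ℚ) = qBinomial (Fintype.card F) n j := by
  have h := card_flatRank_eq (F := F) (n := n) hj fun _ => True
  have h2 := card_submodule_finrank_eq (K := F) (V := Fin n → F) j
  simp only [true_and] at h
  rw [Module.finrank_fin_fun] at h2
  rw [h, h2]

open Classical in
theorem card_flatRank_le_eq_qBinomial [Fintype F] (S : MatroidFlat (vectorSpaceMatroid F n r))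
    (hS : flatRank _ S < r) (j : ℕ) :
    ((Finset.univ.filter fun T : MatroidFlat (vectorSpaceMatroid F n r) =>
      T ≤ S ∧ flatRank _ T = j).card : ℚ) = qBinomial (Fintype.card F) (flatRank _ S) j := by
  by_cases hj : j < r
  · obtain ⟨W, hW, hW'⟩ := exists_submodule_of_flatRank_lt hS
    have h := card_flatRank_eq (F := F) (n := n) hj fun T => T ⊆ S.1
    have h2 := card_submodule_finrank_eq (K := F) (V := W) j
    rw [hW'] at h2
    rw [← h2]
    refine congrArg _ (h.trans (Nat.card_congr ?_))
    refine (((Submodule.MapSubtype.orderIso W).toEquiv.subtypeEquiv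
      (q := fun U => Module.finrank F U.1 = j) fun U => ?_).trans
        ((Equiv.subtypeSubtypeEquivSubtypeInter (fun U => U ≤ W)
          fun U => Module.finrank F U = j).trans
          (Equiv.subtypeEquivRight fun U => ?_))).symm
    · have : Module.finrank F (U.map W.subtype) = Module.finrank F U :=
        Submodule.finrank_map_subtype_eq W U
      change _ ↔ Module.finrank F (U.map W.subtype) = j
      rw [this]
    · rw [← hW]
      rfl
  · have h0 : (Finset.univ.filter fun T : MatroidFlat (vectorSpaceMatroid F n r) =>
        T ≤ S ∧ flatRank _ T = j) = ∅ := by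
      refine Finset.filter_eq_empty_iff.2 fun T _ h => ?_
      have := (isGeometricRank_flatRank (vectorSpaceMatroid F n r)).strictMono.monotone h.1
      omega
    rw [h0, qBinomial, if_neg (by omega), Finset.card_empty, Nat.cast_zero]

end VectorSpaceMatroid

/-! ### The recursion for the q-secant numbers. -/

section SecantNumbers

theorem qPochhammer_self (q : ℚ) (n : ℕ) : qPochhammer q q n = (1 - q) ^ n * qFactorial q n := by
  rw [qPochhammer, qFactorial, Finset.prod_congr rfl fun i _ =>
    show 1 - q * q ^ i = (1 - q) * qInt q (i + 1) by
      linear_combination qInt_mul_sub_one q (i + 1), Finset.prod_mul_distrib, Finset.prod_const,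
    Finset.card_range]

theorem constantCoeff_coshq (q : ℚ) : PowerSeries.constantCoeff (coshq q) = 1 := by
  rw [← PowerSeries.coeff_zero_eq_constantCoeff_apply, coshq, PowerSeries.coeff_mk]
  simp [qPochhammer]

theorem coshq_mul_sechq (q : ℚ) : coshq q * sechq q = 1 :=
  PowerSeries.mul_inv_cancel _ (by rw [constantCoeff_coshq]; exact one_ne_zero)

theorem rescale_neg_one_coshq (q : ℚ) : PowerSeries.rescale (-1) (coshq q) = coshq q := by
  ext m
  rw [PowerSeries.coeff_rescale, coshq, PowerSeries.coeff_mk]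
  by_cases h : Even m
  · rw [h.neg_one_pow, one_mul]
  · rw [if_neg h, mul_zero]

theorem rescale_neg_one_sinhq (q : ℚ) : PowerSeries.rescale (-1) (sinhq q) = -sinhq q := by
  ext m
  rw [PowerSeries.coeff_rescale, map_neg, sinhq, PowerSeries.coeff_mk]
  by_cases h : Odd m
  · rw [h.neg_one_pow, neg_one_mul]
  · rw [if_neg h, mul_zero, neg_zero]

/-- The substitution t ↦ -t is a ring homomorphism fixing cosh_q, hence it fixes the inverse. This
parity removes tanh_q from the even coefficients. -/
theorem rescale_neg_one_sechq (q : ℚ) : PowerSeries.rescale (-1) (sechq q) = sechq q := by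
  have h := congrArg (PowerSeries.rescale (-1)) (coshq_mul_sechq q)
  rw [map_mul, rescale_neg_one_coshq, map_one] at h
  calc PowerSeries.rescale (-1) (sechq q)
      = (coshq q * sechq q) * PowerSeries.rescale (-1) (sechq q) := by
        rw [coshq_mul_sechq, one_mul]
    _ = sechq q * (coshq q * PowerSeries.rescale (-1) (sechq q)) := by ring
    _ = sechq q := by rw [h, mul_one]

theorem coeff_sechq_of_odd (q : ℚ) {m : ℕ} (hm : Odd m) : PowerSeries.coeff m (sechq q) = 0 := by
  have h := congrArg (PowerSeries.coeff m) (rescale_neg_one_sechq q)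
  rw [PowerSeries.coeff_rescale, hm.neg_one_pow] at h
  linarith

theorem coeff_tanhq_of_even (q : ℚ) {m : ℕ} (hm : Even m) : PowerSeries.coeff m (tanhq q) = 0 := by
  have h : PowerSeries.rescale (-1) (tanhq q) = -tanhq q := by
    have h1 : tanhq q = sinhq q * sechq q := rfl
    rw [h1, map_mul, rescale_neg_one_sinhq, rescale_neg_one_sechq, neg_mul]
  have h := congrArg (PowerSeries.coeff m) h
  rw [PowerSeries.coeff_rescale, hm.neg_one_pow, map_neg] at h
  linarith

theorem qTangentSecant_two_mul (q : ℚ) (k : ℕ) :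
    qTangentSecant q (2 * k) = qPochhammer q q (2 * k) * PowerSeries.coeff (2 * k) (sechq q) := by
  rw [qTangentSecant, map_add, coeff_tanhq_of_even q (even_two_mul k), add_zero]

theorem qTangentSecant_zero (q : ℚ) : qTangentSecant q 0 = 1 := by
  have h := qTangentSecant_two_mul q 0
  have h1 := congrArg PowerSeries.constantCoeff (coshq_mul_sechq q)
  rw [map_mul, constantCoeff_coshq, one_mul, map_one] at h1
  rw [Nat.mul_zero, PowerSeries.coeff_zero_eq_constantCoeff_apply, h1] at h
  simpa [qPochhammer] using h

theorem sum_range_two_mul_add_one {R : Type*} [AddCommMonoid R] (f : ℕ → R)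
    (hf : ∀ i, Odd i → f i = 0) (k : ℕ) :
    ∑ i ∈ Finset.range (2 * k + 1), f i = ∑ j ∈ Finset.range (k + 1), f (2 * j) := by
  induction k with
  | zero => simp
  | succ k ih =>
    rw [Finset.sum_range_succ _ (k + 1), ← ih, show 2 * (k + 1) + 1 = 2 * k + 1 + 1 + 1 by ring,
      Finset.sum_range_succ, Finset.sum_range_succ, hf _ (odd_two_mul_add_one k), add_zero]
    rfl

theorem sum_coeff_sechq_div {q : ℚ} {k : ℕ} (hk : 0 < k) :
    ∑ j ∈ Finset.range (k + 1),
      PowerSeries.coeff (2 * j) (sechq q) / qPochhammer q q (2 * (k - j)) = 0 := by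
  have h := congrArg (PowerSeries.coeff (2 * k)) (coshq_mul_sechq q)
  rw [mul_comm (coshq q), PowerSeries.coeff_mul, PowerSeries.coeff_one, if_neg (by omega),
    Finset.Nat.sum_antidiagonal_eq_sum_range_succ_mk, Nat.succ_eq_add_one,
    sum_range_two_mul_add_one] at h
  · rw [← h]
    refine Finset.sum_congr rfl fun j _ => ?_
    dsimp only
    rw [← Nat.mul_sub, coshq, PowerSeries.coeff_mk, if_pos (even_two_mul _)]
    ring
  · intro i hi
    dsimp only
    rw [coeff_sechq_of_odd q hi, zero_mul]

/-- The recursion that defines the `q`-secant numbers. -/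
theorem sum_qTangentSecant_div {q : ℚ} (hq : 1 < q) {k : ℕ} (hk : 0 < k) :
    ∑ j ∈ Finset.range (k + 1), qTangentSecant q (2 * j) / qFactorial q (2 * j) *
      (1 / qFactorial q (2 * (k - j))) = 0 := by
  have h := sum_coeff_sechq_div (q := q) hk
  -- As (q;q)_m = (1 - q)^m [m]_q!, this factor turns all Pochhammer symbols into q-factorials at
  -- once.
  have h2 := congrArg (fun x => (1 - q) ^ (2 * k) * x) h
  rw [mul_zero, Finset.mul_sum] at h2
  rw [← h2]
  refine Finset.sum_congr rfl fun j hj => ?_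
  have hj' := Finset.mem_range.1 hj
  have h0 : (1 - q) ≠ 0 := by linarith
  have h1 := (qFactorial_pos (q := q) (by linarith) (2 * j)).ne'
  have h3 := (qFactorial_pos (q := q) (by linarith) (2 * (k - j))).ne'
  rw [qTangentSecant_two_mul, qPochhammer_self, qPochhammer_self]
  have h4 : (1 - q) ^ (2 * k) = (1 - q) ^ (2 * j) * (1 - q) ^ (2 * (k - j)) := by
    rw [← pow_add]
    congr 1
    omega
  rw [h4]
  field_simp

theorem sum_qBinomial_mul_qTangentSecant {q : ℚ} (hq : 1 < q) {k : ℕ} (hk : 0 < k) :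
    ∑ j ∈ Finset.range (k + 1), qBinomial q (2 * k) (2 * j) * qTangentSecant q (2 * j) = 0 := by
  have h := congrArg (fun x => qFactorial q (2 * k) * x) (sum_qTangentSecant_div hq hk)
  rw [mul_zero, Finset.mul_sum] at h
  rw [← h]
  refine Finset.sum_congr rfl fun j hj => ?_
  have hj' := Finset.mem_range.1 hj
  rw [qBinomial, if_pos (by omega), ← Nat.mul_sub]
  ring

end SecantNumbers

/-! ### Reciprocal power series and Hessenberg determinants. -/

section ToeplitzDeterminant

/-- The coefficients of the inverse of a power series with constant coefficient `1` are, up to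
sign, Toeplitz–Hessenberg determinants. -/
theorem det_toeplitzHessenberg {R : Type*} [CommRing R] (b c : ℕ → R) (hc : c 0 = 1)
    (hb : b 0 = 1) (h : ∀ k, 0 < k → ∑ j ∈ Finset.range (k + 1), b j * c (k - j) = 0) (a : ℕ) :
    (Matrix.of fun i j : Fin a =>
      if j.val ≤ i.val then c (i.val - j.val + 1) else if j.val = i.val + 1 then 1 else 0).det =
      (-1) ^ a * b a := by
  -- The unitriangular Toeplitz matrix T sends the vector b to the first basis vector, so b a is an
  -- entry of its adjugate. The corresponding minor, without row 0 and the last column, is the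
  -- Hessenberg matrix.
  let T : Matrix (Fin (a + 1)) (Fin (a + 1)) R :=
    Matrix.of fun i j => if j.val ≤ i.val then c (i.val - j.val) else 0
  have hdet : T.det = 1 := by
    rw [Matrix.det_of_isLowerTriangular T]
    · exact Finset.prod_eq_one fun i _ => by simp [T, hc]
    · intro i j hij
      exact if_neg (not_le.2 (by simpa using hij))
  have hTu : T.mulVec (fun j => b j.val) = Pi.single 0 1 := by
    funext i
    have h1 : T.mulVec (fun j => b j.val) i =
        ∑ j ∈ Finset.range (i.val + 1), b j * c (i.val - j) := by
      have h2 : T.mulVec (fun j => b j.val) i =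
        ∑ j : Fin (a + 1), (if j.val ≤ i.val then c (i.val - j.val) else 0) * b j.val := rfl
      rw [h2, Fin.sum_univ_eq_sum_range (fun j => (if j ≤ i.val then c (i.val - j) else 0) * b j)]
      rw [← Finset.sum_subset (Finset.range_mono (Nat.succ_le_of_lt i.isLt))]
      · refine Finset.sum_congr rfl fun j hj => ?_
        rw [if_pos (Nat.lt_succ_iff.1 (Finset.mem_range.1 hj)), mul_comm]
      · intro j _ hj
        rw [Finset.mem_range] at hj
        rw [if_neg (by omega), zero_mul]
    rw [h1]
    rcases eq_or_ne i 0 with rfl | hi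
    · simp [hb, hc]
    · rw [Pi.single_eq_of_ne hi, h _ (Nat.pos_of_ne_zero fun h0 => hi (Fin.ext h0))]
  have hadj : T.adjugate (Fin.last a) 0 = b a := by
    have h1 := congrArg (fun v => T.adjugate.mulVec v (Fin.last a)) hTu
    rw [Matrix.mulVec_mulVec, Matrix.adjugate_mul, hdet, one_smul, Matrix.one_mulVec,
      Matrix.mulVec_single_one] at h1
    exact h1.symm
  rw [Matrix.adjugate_fin_succ_eq_det_submatrix] at hadj
  have hsub : T.submatrix (Fin.succAbove 0) (Fin.succAbove (Fin.last a)) =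
      Matrix.of fun i j : Fin a =>
      if j.val ≤ i.val then c (i.val - j.val + 1) else if j.val = i.val + 1 then 1 else 0 := by
    ext i j
    simp only [T, Matrix.submatrix_apply, Matrix.of_apply, Fin.succAbove_zero, Fin.succAbove_last,
      Fin.val_succ, Fin.val_castSucc]
    rcases lt_trichotomy j.val (i.val + 1) with hlt | heq | hgt
    · rw [if_pos hlt.le, if_pos (by omega), Nat.sub_add_comm (by omega)]
    · rw [if_pos heq.le, if_neg (by omega), if_pos heq, heq, Nat.sub_self, hc]
    · rw [if_neg (by omega), if_neg (by omega), if_neg (by omega)]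
  rw [hsub] at hadj
  rw [← hadj, ← mul_assoc, Fin.val_zero, Fin.val_last, zero_add, ← mul_pow, neg_one_mul, neg_neg,
    one_pow, one_mul]

theorem secantDet_eq {q : ℚ} (hq : 1 < q) (a : ℕ) :
    secantDet q a = (-1) ^ a * (qTangentSecant q (2 * a) / qFactorial q (2 * a)) :=
  det_toeplitzHessenberg (fun j => qTangentSecant q (2 * j) / qFactorial q (2 * j))
    (fun j => 1 / qFactorial q (2 * j)) (by simp [qFactorial])
    (by simp [qFactorial, qTangentSecant_zero]) (fun _ hk => sum_qTangentSecant_div hq hk) a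

theorem sum_qBinomial_eq_secantDet {q : ℚ} (hq : 1 < q) {n K : ℕ} (hK : 2 * K ≤ n) :
    ∑ k ∈ Finset.range (K + 1), qBinomial q n (2 * k) * qTangentSecant q (2 * k) =
      1 + qFactorial q n *
        ∑ a ∈ Finset.Icc 1 K, (-1) ^ a / qFactorial q (n - 2 * a) * secantDet q a := by
  have h0 := (qFactorial_pos (q := q) (by linarith) n).ne'
  have h1 : qBinomial q n (2 * 0) * qTangentSecant q (2 * 0) = 1 := by
    rw [Nat.mul_zero, qTangentSecant_zero, mul_one, qBinomial, if_pos (Nat.zero_le _), Nat.sub_zero,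
      show qFactorial q 0 = 1 by simp [qFactorial], one_mul, div_self h0]
  rw [Finset.range_eq_Ico, Finset.sum_eq_sum_Ico_succ_bot (by omega), h1, Finset.mul_sum]
  congr 1
  refine Finset.sum_congr (by ext; simp) fun a ha => ?_
  have ha' := Finset.mem_Icc.1 ha
  rw [secantDet_eq hq, qBinomial, if_pos (by omega)]
  have h2 : ((-1 : ℚ) ^ a) * (-1) ^ a = 1 := by rw [← mul_pow]; norm_num
  linear_combination (-(qFactorial q n / qFactorial q (n - 2 * a) *
    (qTangentSecant q (2 * a) / qFactorial q (2 * a)))) * h2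

end ToeplitzDeterminant

/-! ### Assembly of the theorem. -/

theorem theorem1p2 {F : Type*} [Field F] [Fintype F] (q n r : ℕ) (hq : Fintype.card F = q)
    (hr : Odd r) (hrn : r ≤ n) :
    (∀ d : ℕ, Module.IsTorsionFree ℤ (chowComponent (vectorSpaceMatroid F n r) d)) ∧
    (∃ H : Polynomial ℤ, H.degree = ((r - 1 : ℕ) : WithBot ℕ) ∧
      (H : PowerSeries ℤ) = hilbertSeries (chowComponent (vectorSpaceMatroid F n r))) ∧
    (charneyDavis (chowComponent (vectorSpaceMatroid F n r)) : ℚ) =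
      (-1) ^ ((r - 1) / 2) *
        ∑ k ∈ Finset.range ((r - 1) / 2 + 1),
          qBinomial (q : ℚ) n (2 * k) * qTangentSecant (q : ℚ) (2 * k) ∧
    (charneyDavis (chowComponent (vectorSpaceMatroid F n r)) : ℚ) =
      (-1) ^ ((r - 1) / 2) *
        (1 + qFactorial (q : ℚ) n *
          ∑ a ∈ Finset.Icc 1 ((r - 1) / 2),
            (-1) ^ a / qFactorial (q : ℚ) (n - 2 * a) * secantDet (q : ℚ) a) := by
  subst hq
  set M := vectorSpaceMatroid F n r
  have hrk := isGeometricRank_flatRank M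
  have hq : (1 : ℚ) < Fintype.card F := by exact_mod_cast Fintype.one_lt_card
  have hodd : r % 2 = 1 := Nat.odd_iff.1 hr
  obtain ⟨t, ht⟩ := exists_flatRank_vectorSpaceMatroid_eq (F := F) hrn
  have hdeg := degree_fyPolynomial hrk hr.pos flatRank_vectorSpaceMatroid_le ht
  have hH : (fyPolynomial (flatRank M) : PowerSeries ℤ) = hilbertSeries (chowComponent M) := by
    ext d
    rw [Polynomial.coeff_coe, coeff_fyPolynomial, hilbertSeries, PowerSeries.coeff_mk,
      finrank_chowComponent]
  have hnat : (fyPolynomial (flatRank M)).natDegree = r - 1 :=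
    Polynomial.natDegree_eq_of_degree_eq_some hdeg
  have heval := eval_fyPolynomial_of_recursion hrk hr flatRank_vectorSpaceMatroid_le
    (fun j => qBinomial (Fintype.card F) n j) (fun i j => qBinomial (Fintype.card F) i j)
    (fun k => qTangentSecant (Fintype.card F) (2 * k)) (fun j hj => card_flatRank_eq_qBinomial hj)
    card_flatRank_le_eq_qBinomial (qBinomial_self (by linarith)) (qTangentSecant_zero _)
    (fun k hk _ => sum_qBinomial_mul_qTangentSecant hq hk)
  have hCD : (charneyDavis (chowComponent M) : ℚ) = (-1) ^ ((r - 1) / 2) *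
      ∑ k ∈ Finset.range ((r - 1) / 2 + 1),
        qBinomial (Fintype.card F) n (2 * k) * qTangentSecant (Fintype.card F) (2 * k) := by
    rw [charneyDavis_eq _ _ hH, charneyDavisOfPolynomial, hnat,
      if_pos (by rw [Nat.even_iff]; omega), Int.cast_mul, heval]
    simp
  refine ⟨isTorsionFree_chowComponent M, ⟨_, hdeg, hH⟩, hCD, ?_⟩
  rw [hCD, sum_qBinomial_eq_secantDet hq (by omega)]
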